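/- Let $R$ be a commutative ring, $\underline{x}=x_1,\ldots,x_k$ a finite sequence of elements of $R$, $\mathfrak a=(x_1,\ldots,x_k)R$, and let $M$ be an $R$-module. Let $\Gamma_{\mathfrak a}(M)=\{m\in M\mid \mathfrak a^n m=0 \text{ for some } n\}$, let $H^i_{\mathfrak a}$ be the $i$-th right derived functor of $\Gamma_{\mathfrak a}$, and let $\mathcal D_{\mathfrak a}(M)=\varinjlim_n \operatorname{Hom}_R(\mathfrak a^n,M)$. Let $\check C_{\underline x}$ be the Čech complex, with $\check C^p_{\underline x}=\bigoplus_{i_1<\cdots<i_p}R_{x_{i_1}\cdots x_{i_p}}$ (so $\check C^0_{\underline x}=R$), and let $\check D_{\underline x}$ be the kernel of the natural surjection $\check C_{\underline x}\to R$ onto $R$ placed in degree $0$; thus $H^1(\check D_{\underline x}\otimes_R M)=\ker\big(\bigoplus_i M_{x_i}\to\bigoplus_{i<j}M_{x_ix_j}\big)$. (a) The natural map $H^1_{\mathfrak a}(M)\to H^1(\check C_{\underline x}\otimes_R M)$ is injective, and there is a commutative diagram of natural maps with exact rows $$ \begin{array}{ccccccccccc} 0&\to&\Gamma_{\mathfrak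 a}(M)&\to& M&\xrightarrow{\tau_M}&\mathcal D_{\mathfrak a}(M)&\to& H^1_{\mathfrak a}(M)&\to&0\\ &&\downarrow{\scriptstyle\cong}&&\downarrow{\scriptstyle =}&&\downarrow{\scriptstyle\rho_M}&&\downarrow&&\\ 0&\to&H^0(\check C_{\underline x}\otimes_R M)&\to& M&\to&H^1(\check D_{\underline x}\otimes_R M)&\to& H^1(\check C_{\underline x}\otimes_R M)&\to&0 \end{array} $$ in which $\rho_M$ is the map that sends the class of $g:\mathfrak a^n\to M$ to $(g(x_i^n)/x_i^n)_i$; the map $\rho_M$ is injective as well. In particular the diagram induces an isomorphism $$H^1(\check D_{\underline x}\otimes_R M)/\mathcal D_{\mathfrak a}(M)\cong H^1(\check C_{\underline x}\otimes_R M)/H^1_{\mathfrak a}(M).$$ (b) The natural injection $M/\Gamma_{\mathfrak a}(M)\hookrightarrow H^1(\check D_{\underline x}\otimes_R M)$, $m\mapsto (m/1)_i$, factors through the injection $\rho_M:\mathcal D_{\mathfrak a}(M)\hookrightarrow H^1(\check D_{\underline x}\otimes_R M)$. (c) (Deligne's formula) Suppose that $\underline x$ is weakly pro-regular, that is, for all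 $i\ge 1$ and $n\ge 1$ there is an $m\ge n$ such that the natural map of Koszul homology modules $H_i(x_1^m,\ldots,x_k^m;R)\to H_i(x_1^n,\ldots,x_k^n;R)$ is zero. Then $\rho_M$ is an isomorphism $\mathcal D_{\mathfrak a}(M)\cong H^1(\check D_{\underline x}\otimes_R M)$. -/

import Mathlib

open CategoryTheory

universe u

noncomputable section

namespace CechTransform

/-! ### Sequences of indices -/

/-- The increasing sequence obtained from `σ 0 < ⋯ < σ p` by omitting the entry `σ j`. -/
def face {k p : ℕ} (σ : Fin (p + 1) ↪o Fin k) (j : Fin (p + 1)) : Fin p ↪o Fin k :=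
  (Fin.succAboveOrderEmb j).trans σ

theorem face_face {k p : ℕ} (σ : Fin (p + 2) ↪o Fin k) (i : Fin (p + 2)) (j : Fin (p + 1)) :
    face (face σ (i.succAbove j)) (j.predAbove i) = face (face σ i) j := by
  apply DFunLike.ext
  intro l
  exact congrArg σ (Fin.succAbove_succAbove_succAbove_predAbove i j l)

/-- A double alternating sum over all ways to omit two entries one after the other vanishes. -/
theorem sum_sign_eq_zero {R A : Type*} [CommRing R] [AddCommGroup A] [Module R A] (p : ℕ)
    (F : Fin (p + 2) → Fin (p + 1) → A)
    (hF : ∀ i j, F (i.succAbove j) (j.predAbove i) = F i j) :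
    ∑ i : Fin (p + 2), ∑ j : Fin (p + 1), ((-1 : R) ^ ((i : ℕ) + (j : ℕ))) • F i j = 0 := by
  rw [← Fintype.sum_prod_type']
  refine Finset.sum_involution (fun q _ => (q.1.succAbove q.2, q.2.predAbove q.1)) ?_ ?_ ?_ ?_
  · rintro ⟨i, j⟩ -
    simp only [hF]
    rw [← add_smul, Fin.neg_one_pow_succAbove_add_predAbove, add_neg_cancel, zero_smul]
  · rintro ⟨i, j⟩ - - h
    exact Fin.succAbove_ne i j (congrArg Prod.fst h)
  · intros; exact Finset.mem_univ _
  · rintro ⟨i, j⟩ -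
    refine Prod.ext (Fin.succAbove_succAbove_predAbove i j) ?_
    simp only
    ext
    simp only [Fin.succAbove, Fin.predAbove, Fin.lt_def, Fin.val_castSucc, apply_dite Fin.val,
      Fin.val_pred, Fin.coe_castPred, dite_eq_ite, apply_ite Fin.val, Fin.val_succ]
    split_ifs <;> lia

/-! ### The Koszul complex and weakly pro-regular sequences -/

section Koszul

variable {R : Type u} [CommRing R] {k : ℕ}

/-- The Koszul differential: the basis vector `e_σ`, `σ = (σ 0 < ⋯ < σ p)`, is sent to
`∑ j, (-1) ^ j x_{σ j} e_{σ without σ j}`. -/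
def koszulD (x : Fin k → R) (p : ℕ) :
    ((Fin (p + 1) ↪o Fin k) → R) →ₗ[R] ((Fin p ↪o Fin k) → R) :=
  ∑ σ, ∑ j : Fin (p + 1),
    ((-1) ^ (j : ℕ) * x (σ j)) • (LinearMap.single R _ (face σ j) ∘ₗ LinearMap.proj σ)

theorem koszulD_single (x : Fin k → R) (p : ℕ) (σ : Fin (p + 1) ↪o Fin k) (r : R) :
    koszulD x p (Pi.single σ r) =
      ∑ j : Fin (p + 1), ((-1) ^ (j : ℕ) * x (σ j)) • (Pi.single (face σ j) r) := by
  rw [koszulD, LinearMap.sum_apply, Finset.sum_eq_single σ]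
  · simp [LinearMap.sum_apply]
  · intro τ _ hτ
    simp [LinearMap.sum_apply, Pi.single_eq_of_ne hτ]
  · simp

theorem koszulD_comp (x : Fin k → R) (p : ℕ) : koszulD x p ∘ₗ koszulD x (p + 1) = 0 := by
  refine LinearMap.pi_ext fun σ r => ?_
  simp only [LinearMap.comp_apply, koszulD_single, map_sum, map_smul, LinearMap.zero_apply,
    Finset.smul_sum, smul_smul]
  rw [← sum_sign_eq_zero (R := R) p (fun i j =>
    (x (σ i) * x (face σ i j)) • (Pi.single (face (face σ i) j) r : (Fin p ↪o Fin k) → R)) ?_]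
  · refine Finset.sum_congr rfl fun i _ => Finset.sum_congr rfl fun j _ => ?_
    rw [smul_smul, pow_add]
    congr 1
    ring
  · intro i j
    rw [face_face]
    congr 1
    have h1 : face σ (i.succAbove j) (j.predAbove i) = σ i :=
      congrArg σ (Fin.succAbove_succAbove_predAbove i j)
    have h2 : face σ i j = σ (i.succAbove j) := rfl
    rw [h1, h2, mul_comm]

/-- The Koszul complex `K_•(x; R)`, with `K_p` free on the increasing sequences of `p` indices. -/
def koszulComplex (x : Fin k → R) : ChainComplex (ModuleCat.{u} R) ℕ :=
  ChainComplex.of (fun p => ModuleCat.of R ((Fin p ↪o Fin k) → R))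
    (fun p => ModuleCat.ofHom (koszulD x p))
    (fun p => by rw [← ModuleCat.ofHom_comp, koszulD_comp]; rfl)

theorem koszulComplex_d (x : Fin k → R) (p : ℕ) :
    (koszulComplex x).d (p + 1) p = ModuleCat.ofHom (koszulD x p) :=
  ChainComplex.of_d (fun p => ModuleCat.of R ((Fin p ↪o Fin k) → R))
    (fun p => ModuleCat.ofHom (koszulD x p)) p

/-- Multiplication of `e_σ` by `∏ j, y_{σ j}`. -/
def koszulScale (y : Fin k → R) (p : ℕ) :
    ((Fin p ↪o Fin k) → R) →ₗ[R] ((Fin p ↪o Fin k) → R) :=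
  LinearMap.pi fun σ => (∏ j, y (σ j)) • LinearMap.proj σ

theorem koszulScale_single (y : Fin k → R) (p : ℕ) (σ : Fin p ↪o Fin k) (r : R) :
    koszulScale y p (Pi.single σ r) = (∏ j, y (σ j)) • Pi.single σ r := by
  ext τ
  by_cases h : τ = σ
  · subst h; simp [koszulScale]
  · simp [koszulScale, Pi.single_eq_of_ne h]

theorem koszulScale_comm (x y z : Fin k → R) (h : ∀ i, z i = y i * x i) (p : ℕ) :
    koszulD x p ∘ₗ koszulScale y (p + 1) = koszulScale y p ∘ₗ koszulD z p := by
  refine LinearMap.pi_ext fun σ r => ?_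
  simp only [LinearMap.comp_apply, koszulD_single, koszulScale_single, map_sum, map_smul,
    Finset.smul_sum, smul_smul]
  refine Finset.sum_congr rfl fun j _ => ?_
  congr 1
  rw [Fin.prod_univ_succAbove (fun l => y (σ l)) j, h]
  simp only [face, RelEmbedding.coe_trans, Function.comp_apply, Fin.succAboveOrderEmb_apply]
  ring

/-- The natural map `K_•(x ^ m; R) ⟶ K_•(x ^ n; R)` for `n ≤ m`, which sends `e_σ` to
`(∏ j, x_{σ j} ^ (m - n)) e_σ`. -/
def koszulTransition (x : Fin k → R) {n m : ℕ} (h : n ≤ m) :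
    koszulComplex (fun i => x i ^ m) ⟶ koszulComplex (fun i => x i ^ n) :=
  ChainComplex.ofHom
    (fun p => ModuleCat.ofHom (koszulScale (fun i => x i ^ (m - n)) p))
    (fun p => by
      rw [koszulComplex_d, koszulComplex_d]
      exact congrArg ModuleCat.ofHom (koszulScale_comm (fun i => x i ^ n)
        (fun i => x i ^ (m - n)) (fun i => x i ^ m)
        (fun i => by rw [← pow_add, Nat.sub_add_cancel h]) p))

/-- The sequence `x` is weakly pro-regular: for every `i ≥ 1` the inverse system
`H_i(x ^ n; R)`, `n ≥ 1`, is pro-zero. -/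
def WeaklyProRegular (x : Fin k → R) : Prop :=
  ∀ i : ℕ, 1 ≤ i → ∀ n : ℕ, 1 ≤ n → ∃ (m : ℕ) (h : n ≤ m),
    HomologicalComplex.homologyMap (koszulTransition x h) i = 0

end Koszul

/-! ### The Čech complexes -/

section Cech

variable {R : Type u} [CommRing R] {k : ℕ}

/-- The product `x_{σ 0} ⋯ x_{σ (p - 1)}`. -/
def cechElem (x : Fin k → R) {p : ℕ} (σ : Fin p ↪o Fin k) : R := ∏ j, x (σ j)

theorem cechElem_eq (x : Fin k → R) {p : ℕ} (σ : Fin (p + 1) ↪o Fin k) (j : Fin (p + 1)) :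
    cechElem x σ = x (σ j) * cechElem x (face σ j) :=
  Fin.prod_univ_succAbove (fun l => x (σ l)) j

/-- The `p`-th term of the Čech complex: the direct sum (equivalently, the product) of the
localizations of `R` at the products `x_{σ 0} ⋯ x_{σ (p - 1)}`. -/
abbrev CechTerm (x : Fin k → R) (p : ℕ) : Type u :=
  (σ : Fin p ↪o Fin k) → Localization.Away (cechElem x σ)

/-- The canonical map between the localizations that belong to a face of `σ` and to `σ`. -/
def cechFace (x : Fin k → R) {p : ℕ} (σ : Fin (p + 1) ↪o Fin k) (j : Fin (p + 1)) :
    Localization.Away (cechElem x (face σ j)) →ₐ[R] Localization.Away (cechElem x σ) :=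
  IsLocalization.Away.liftAlgHom (cechElem x (face σ j))
    (f := Algebra.ofId R (Localization.Away (cechElem x σ)))
    (IsLocalization.Away.isUnit_of_dvd (cechElem x σ)
      ⟨x (σ j), by rw [cechElem_eq x σ j, mul_comm]⟩)

/-- The Čech differential. -/
def cechD (x : Fin k → R) (p : ℕ) : CechTerm x p →ₗ[R] CechTerm x (p + 1) :=
  LinearMap.pi fun σ => ∑ j : Fin (p + 1),
    ((-1 : R) ^ (j : ℕ)) • ((cechFace x σ j).toLinearMap ∘ₗ LinearMap.proj (face σ j))

theorem cechD_apply (x : Fin k → R) (p : ℕ) (c : CechTerm x p) (σ : Fin (p + 1) ↪o Fin k) :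
    cechD x p c σ = ∑ j : Fin (p + 1), ((-1 : R) ^ (j : ℕ)) • cechFace x σ j (c (face σ j)) := by
  simp [cechD, LinearMap.sum_apply]

theorem cechFace_cechFace (x : Fin k → R) {p : ℕ} (σ : Fin (p + 2) ↪o Fin k)
    (τ : Fin p ↪o Fin k) (i i' : Fin (p + 2)) (j j' : Fin (p + 1))
    (h : face (face σ i) j = τ) (h' : face (face σ i') j' = τ) (c : CechTerm x p) :
    cechFace x σ i (cechFace x (face σ i) j (c (face (face σ i) j))) =
      cechFace x σ i' (cechFace x (face σ i') j' (c (face (face σ i') j'))) := by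
  have key : ∀ (τ' : Fin p ↪o Fin k) (_ : τ' = τ)
      (f : Localization.Away (cechElem x τ) →ₐ[R] Localization.Away (cechElem x σ))
      (g : Localization.Away (cechElem x τ') →ₐ[R] Localization.Away (cechElem x σ)),
      f (c τ) = g (c τ') := by
    intro τ' hτ f g
    subst hτ
    exact congrArg (fun φ => φ (c _)) ((IsLocalization.algHom_subsingleton
      (Submonoid.powers (cechElem x τ'))).elim f g)
  subst h
  exact key _ h' ((cechFace x σ i).comp (cechFace x (face σ i) j))
    ((cechFace x σ i').comp (cechFace x (face σ i') j'))

theorem cechD_comp (x : Fin k → R) (p : ℕ) : cechD x (p + 1) ∘ₗ cechD x p = 0 := by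
  refine LinearMap.ext fun c => funext fun σ => ?_
  simp only [LinearMap.comp_apply, cechD_apply, map_sum, map_smul, Finset.smul_sum, smul_smul,
    ← pow_add, LinearMap.zero_apply, Pi.zero_apply]
  exact sum_sign_eq_zero (R := R) p (fun i j =>
    cechFace x σ i (cechFace x (face σ i) j (c (face (face σ i) j))))
    fun i j => cechFace_cechFace x σ _ _ _ _ _ (face_face σ i j) rfl c

/-- The Čech complex `Č_x`, with `Č_x^0 = R` and `Č_x^p` the direct sum of the localizations
of `R` at the products of `p` members of the sequence. -/
def cechComplex (x : Fin k → R) : CochainComplex (ModuleCat.{u} R) ℕ :=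
  CochainComplex.of (fun p => ModuleCat.of R (CechTerm x p))
    (fun p => ModuleCat.ofHom (cechD x p))
    (fun p => by rw [← ModuleCat.ofHom_comp, cechD_comp]; rfl)

theorem cechComplex_d (x : Fin k → R) (p : ℕ) :
    (cechComplex x).d p (p + 1) = ModuleCat.ofHom (cechD x p) :=
  CochainComplex.of_d (fun p => ModuleCat.of R (CechTerm x p))
    (fun p => ModuleCat.ofHom (cechD x p)) p

theorem isUnit_cechElem_zero (x : Fin k → R) (σ : Fin 0 ↪o Fin k) : IsUnit (cechElem x σ) := by
  simp [cechElem]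

instance : Unique (Fin 0 ↪o Fin k) where
  default := OrderEmbedding.ofIsEmpty
  uniq _ := DFunLike.ext _ _ fun j => j.elim0

/-- The canonical isomorphism `R ≅ Č_x^0`. -/
def cechZero (x : Fin k → R) : R ≃ₗ[R] CechTerm x 0 :=
  (IsLocalization.atUnit R (Localization.Away (cechElem x (default : Fin 0 ↪o Fin k)))
      (cechElem x default) (isUnit_cechElem_zero x default)).toLinearEquiv ≪≫ₗ
    (LinearEquiv.piUnique R
      (fun σ : Fin 0 ↪o Fin k => Localization.Away (cechElem x σ))).symm

/-- The natural surjective map of complexes `Č_x ⟶ R`, where `R` is placed in degree `0`. -/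
def cechAugmentation (x : Fin k → R) :
    cechComplex x ⟶ (CochainComplex.single₀ (ModuleCat.{u} R)).obj (ModuleCat.of R R) :=
  (CochainComplex.toSingle₀Equiv _ _).symm (ModuleCat.ofHom (cechZero x).symm.toLinearMap)

/-- The global Čech complex `Ď_x`: the kernel of `Č_x ⟶ R`. -/
def globalCechComplex (x : Fin k → R) : CochainComplex (ModuleCat.{u} R) ℕ :=
  Limits.kernel (cechAugmentation x)

/-- The inclusion of `Ď_x` into `Č_x`. -/
def globalCechInclusion (x : Fin k → R) : globalCechComplex x ⟶ cechComplex x :=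
  Limits.kernel.ι (cechAugmentation x)

variable (M : Type u) [AddCommGroup M] [Module R M]

variable (R) in
/-- The functor `C ↦ C ⊗_R M` on cochain complexes of `R`-modules. -/
abbrev tensorFunctor :
    CochainComplex (ModuleCat.{u} R) ℕ ⥤ CochainComplex (ModuleCat.{u} R) ℕ :=
  (MonoidalCategory.tensorRight (ModuleCat.of R M)).mapHomologicalComplex (ComplexShape.up ℕ)

/-- `Č_x ⊗_R M`. -/
abbrev cechTensor (x : Fin k → R) : CochainComplex (ModuleCat.{u} R) ℕ :=
  (tensorFunctor R M).obj (cechComplex x)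

/-- `Ď_x ⊗_R M`. -/
abbrev globalCechTensor (x : Fin k → R) : CochainComplex (ModuleCat.{u} R) ℕ :=
  (tensorFunctor R M).obj (globalCechComplex x)

/-- `Ď_x ⊗_R M ⟶ Č_x ⊗_R M`. -/
abbrev globalCechTensorInclusion (x : Fin k → R) : globalCechTensor M x ⟶ cechTensor M x :=
  (tensorFunctor R M).map (globalCechInclusion x)

theorem cechTensor_d (x : Fin k → R) (p : ℕ) :
    ((cechTensor M x).d p (p + 1)).hom = (cechD x p).rTensor M := by
  change (MonoidalCategory.whiskerRight ((cechComplex x).d p (p + 1)) (ModuleCat.of R M)).hom = _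
  rw [cechComplex_d]
  rfl

instance globalCechInclusion_isIso (x : Fin k → R) (p : ℕ) :
    IsIso ((globalCechInclusion x).f (p + 1)) := by
  have h0 : (cechAugmentation x).f (p + 1) = 0 :=
    (HomologicalComplex.isZero_single_obj_X (ComplexShape.up ℕ) 0 (ModuleCat.of R R) (p + 1)
      (by simp)).eq_of_tgt _ _
  exact Limits.KernelFork.IsLimit.isIso_ι _ (Limits.KernelFork.mapIsLimit _
    (Limits.kernelIsKernel (cechAugmentation x))
    (HomologicalComplex.eval (ModuleCat.{u} R) (ComplexShape.up ℕ) (p + 1))) h0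

instance globalCechTensorInclusion_isIso (x : Fin k → R) (p : ℕ) :
    IsIso ((globalCechTensorInclusion M x).f (p + 1)) :=
  inferInstanceAs (IsIso ((MonoidalCategory.tensorRight (ModuleCat.of R M)).map _))

end Cech

/-! ### Cohomology classes -/

section Class

variable {R : Type u} [CommRing R]

/-- The map that sends a cocycle of a complex of modules to its cohomology class. -/
def cohomologyClass (K : CochainComplex (ModuleCat.{u} R) ℕ) (n : ℕ) :
    LinearMap.ker (K.d n (n + 1)).hom →ₗ[R] K.homology n :=
  (K.liftCycles (ModuleCat.ofHom (LinearMap.ker (K.d n (n + 1)).hom).subtype) (n + 1)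
    (by simp) (by ext z; exact z.2) ≫ K.homologyπ n).hom

theorem cohomologyClass_surjective (K : CochainComplex (ModuleCat.{u} R) ℕ) (n : ℕ) :
    Function.Surjective (cohomologyClass K n) := by
  intro c
  obtain ⟨w, rfl⟩ := (ModuleCat.epi_iff_surjective (K.homologyπ n)).1 inferInstance c
  have hw : (K.d n (n + 1)).hom ((K.iCycles n).hom w) = 0 :=
    congrArg (fun f => f.hom w) (K.iCycles_d n (n + 1))
  refine ⟨⟨(K.iCycles n).hom w, hw⟩, ?_⟩
  refine congrArg (K.homologyπ n).hom ?_
  apply (ModuleCat.mono_iff_injective (K.iCycles n)).1 inferInstance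
  exact congrArg (fun f => f.hom (⟨(K.iCycles n).hom w, hw⟩ : LinearMap.ker (K.d n (n + 1)).hom))
    (K.liftCycles_i (ModuleCat.ofHom (LinearMap.ker (K.d n (n + 1)).hom).subtype) (n + 1)
      (by simp) (by ext z; exact z.2))

theorem cohomologyClass_eq_zero_iff (K : CochainComplex (ModuleCat.{u} R) ℕ) (n : ℕ)
    (z : LinearMap.ker (K.d (n + 1) (n + 1 + 1)).hom) :
    cohomologyClass K (n + 1) z = 0 ↔ ∃ w, (K.d n (n + 1)).hom w = z := by
  set j := K.liftCycles (ModuleCat.ofHom (LinearMap.ker (K.d (n + 1) (n + 1 + 1)).hom).subtype)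
    (n + 1 + 1) (by simp) (by ext z; exact z.2) with hj
  have hji : j ≫ K.iCycles (n + 1) =
      ModuleCat.ofHom (LinearMap.ker (K.d (n + 1) (n + 1 + 1)).hom).subtype := by
    rw [hj]; exact K.liftCycles_i _ _ _ _
  have hjz : (K.iCycles (n + 1)).hom (j.hom z) = z := congrArg (fun f => f.hom z) hji
  have hex : (ShortComplex.mk (K.toCycles n (n + 1)) (K.homologyπ (n + 1)) (by simp)).Exact :=
    ShortComplex.exact_of_g_is_cokernel _ (K.homologyIsCokernel n (n + 1) (by simp))
  have hex' := (ShortComplex.ShortExact.moduleCat_exact_iff_function_exact _).1 hex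
  have key : cohomologyClass K (n + 1) z = (K.homologyπ (n + 1)).hom (j.hom z) := rfl
  rw [key]
  refine (hex' (j.hom z)).trans ⟨?_, ?_⟩
  · rintro ⟨w, hw⟩
    refine ⟨w, ?_⟩
    rw [← hjz, ← hw]
    exact (congrArg (fun f => f.hom w) (K.toCycles_i n (n + 1))).symm
  · rintro ⟨w, hw⟩
    refine ⟨w, ?_⟩
    apply (ModuleCat.mono_iff_injective (K.iCycles (n + 1))).1 inferInstance
    refine (congrArg (fun f => f.hom w) (K.toCycles_i n (n + 1))).trans ?_
    exact hw.trans hjz.symm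

end Class

/-! ### Torsion and local cohomology -/

section Torsion

variable {R : Type u} [CommRing R] (a : Ideal R)

/-- `Γ_a(M)`: the elements of `M` that are annihilated by a power of `a`. -/
def torsionSubmodule (M : Type u) [AddCommGroup M] [Module R M] : Submodule R M where
  carrier := {m | ∃ n : ℕ, ∀ r ∈ a ^ n, r • m = 0}
  zero_mem' := ⟨0, fun _ _ => smul_zero _⟩
  add_mem' := by
    rintro m m' ⟨n, hn⟩ ⟨n', hn'⟩
    refine ⟨n + n', fun r hr => ?_⟩
    rw [smul_add, hn r (Ideal.pow_le_pow_right (Nat.le_add_right n n') hr),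
      hn' r (Ideal.pow_le_pow_right (Nat.le_add_left n' n) hr), add_zero]
  smul_mem' := by
    rintro c m ⟨n, hn⟩
    exact ⟨n, fun r hr => by rw [smul_comm, hn r hr, smul_zero]⟩

theorem map_mem_torsionSubmodule {M N : Type u} [AddCommGroup M] [Module R M] [AddCommGroup N]
    [Module R N] (f : M →ₗ[R] N) {m : M} (hm : m ∈ torsionSubmodule a M) :
    f m ∈ torsionSubmodule a N := by
  obtain ⟨n, hn⟩ := hm
  exact ⟨n, fun r hr => by rw [← map_smul, hn r hr, map_zero]⟩

/-- The functor `Γ_a`. -/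
def torsionFunctor : ModuleCat.{u} R ⥤ ModuleCat.{u} R where
  obj M := ModuleCat.of R (torsionSubmodule a M)
  map f := ModuleCat.ofHom (f.hom.restrict fun _ => map_mem_torsionSubmodule a f.hom)

instance : (torsionFunctor a).Additive where

/-- The local cohomology functor `H^i_a`, the `i`-th right derived functor of `Γ_a`. -/
def localCohomologyFunctor (i : ℕ) : ModuleCat.{u} R ⥤ ModuleCat.{u} R :=
  (torsionFunctor a).rightDerived i

/-- `H^i_a(M)`. -/
abbrev LocalCohomology (i : ℕ) (M : Type u) [AddCommGroup M] [Module R M] : ModuleCat.{u} R :=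
  (localCohomologyFunctor a i).obj (ModuleCat.of R M)

end Torsion

/-! ### Ideal transforms -/

section Transform

variable {R : Type u} [CommRing R] (a : Ideal R) (M : Type u) [AddCommGroup M] [Module R M]

/-- The restriction map `Hom_R(a ^ n, M) → Hom_R(a ^ m, M)` for `n ≤ m`. -/
def restrictPow (n m : ℕ) (h : n ≤ m) : (↥(a ^ n) →ₗ[R] M) →ₗ[R] (↥(a ^ m) →ₗ[R] M) :=
  LinearMap.lcomp R M (Submodule.inclusion (Ideal.pow_le_pow_right h))

/-- The ideal transform `D_a(M)`: the direct limit of the modules `Hom_R(a ^ n, M)`. -/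
abbrev IdealTransform : Type u :=
  Module.DirectLimit (fun n : ℕ => ↥(a ^ n) →ₗ[R] M) (restrictPow a M)

/-- The natural map `Hom_R(a ^ n, M) → D_a(M)`. -/
abbrev IdealTransform.of (n : ℕ) : (↥(a ^ n) →ₗ[R] M) →ₗ[R] IdealTransform a M :=
  Module.DirectLimit.of R ℕ (fun n : ℕ => ↥(a ^ n) →ₗ[R] M) (restrictPow a M) n

/-- The natural map `τ_M : M → D_a(M)`; it sends `m` to the class of `r ↦ r • m`. -/
def toIdealTransform : M →ₗ[R] IdealTransform a M :=
  IdealTransform.of a M 0 ∘ₗ LinearMap.lcomp R M (a ^ 0).subtype ∘ₗ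
    (LinearMap.ringLmapEquivSelf R R M).symm.toLinearMap

end Transform

/-! ### The maps of the diagram -/

section Maps

open TensorProduct

variable {R : Type u} [CommRing R] {k : ℕ} (x : Fin k → R)

/-- The ideal generated by the sequence `x`. -/
abbrev idealOf : Ideal R := Ideal.span (Set.range x)

variable (M : Type u) [AddCommGroup M] [Module R M]

/-- The canonical map `H^0(Č_x ⊗ M) → Č_x^0 ⊗ M ≅ M`. -/
def cechCohomologyZeroToModule : (cechTensor M x).homology 0 →ₗ[R] M :=
  (TensorProduct.lid R M).toLinearMap ∘ₗ (cechZero x).symm.toLinearMap.rTensor M ∘ₗ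
    ((cechTensor M x).isoHomologyπ₀.inv ≫ (cechTensor M x).iCycles 0).hom

/-- The canonical map `H^1(Ď_x ⊗ M) → H^1(Č_x ⊗ M)`. -/
def globalCechToCech : (globalCechTensor M x).homology 1 →ₗ[R] (cechTensor M x).homology 1 :=
  (HomologicalComplex.homologyMap (globalCechTensorInclusion M x) 1).hom

theorem cechTensor_d_apply (p : ℕ) (c : CechTerm x p ⊗[R] M) :
    ((cechTensor M x).d p (p + 1)).hom c = (cechD x p).rTensor M c :=
  congrArg (fun f => f c) (cechTensor_d M x p)

/-- The class in `H^1(Č_x ⊗ M)` of a `1`-cocycle of `Č_x ⊗ M`. -/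
def cechClass : LinearMap.ker ((cechD x 1).rTensor M) →ₗ[R] (cechTensor M x).homology 1 :=
  cohomologyClass (cechTensor M x) 1 ∘ₗ
    Submodule.inclusion (le_of_eq (congrArg LinearMap.ker (cechTensor_d M x 1).symm))

/-- The class in `H^1(Ď_x ⊗ M)` of a `1`-cocycle of `Č_x ⊗ M`; note that `Ď_x` and `Č_x` agree
in positive degrees. -/
def globalCechClass :
    LinearMap.ker ((cechD x 1).rTensor M) →ₗ[R] (globalCechTensor M x).homology 1 :=
  cohomologyClass (globalCechTensor M x) 1 ∘ₗ
    LinearMap.restrict (p := LinearMap.ker ((cechD x 1).rTensor M))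
      (q := LinearMap.ker ((globalCechTensor M x).d 1 (1 + 1)).hom)
      (inv ((globalCechTensorInclusion M x).f (0 + 1))).hom (by
        intro z hz
        have hc : inv ((globalCechTensorInclusion M x).f (0 + 1)) ≫
            (globalCechTensor M x).d 1 (1 + 1) =
            (cechTensor M x).d 1 (1 + 1) ≫ inv ((globalCechTensorInclusion M x).f (1 + 1)) := by
          rw [IsIso.inv_comp_eq, ← Category.assoc, IsIso.eq_comp_inv]
          exact ((globalCechTensorInclusion M x).comm 1 (1 + 1)).symm
        refine (congrArg (fun f => f.hom z) hc).trans ?_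
        change (inv ((globalCechTensorInclusion M x).f (1 + 1))).hom
          (((cechTensor M x).d 1 (1 + 1)).hom z) = 0
        rw [cechTensor_d_apply x M 1 z]
        exact (congrArg _ hz).trans (map_zero _))

/-- The map `M → Č_x^1 ⊗ M = ⨁ M_{x_i}`, which sends `m` to `d^0(1 ⊗ m) = (m / 1)_i`. -/
def cechUnit : M →ₗ[R] CechTerm x 1 ⊗[R] M :=
  (cechD x 0).rTensor M ∘ₗ TensorProduct.mk R (CechTerm x 0) M 1

theorem cechD_rTensor_cechD_rTensor (p : ℕ) (c : CechTerm x p ⊗[R] M) :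
    (cechD x (p + 1)).rTensor M ((cechD x p).rTensor M c) = 0 := by
  rw [← LinearMap.comp_apply, ← LinearMap.rTensor_comp, cechD_comp, LinearMap.rTensor_zero,
    LinearMap.zero_apply]

theorem cechUnit_mem_ker (m : M) :
    cechUnit x M m ∈ LinearMap.ker ((cechD x 1).rTensor M) :=
  cechD_rTensor_cechD_rTensor x M 0 (1 ⊗ₜ[R] m)

/-- The natural map `M → H^1(Ď_x ⊗ M)`, `m ↦ [(m / 1)_i]`. -/
def toGlobalCech : M →ₗ[R] (globalCechTensor M x).homology 1 :=
  globalCechClass x M ∘ₗ (cechUnit x M).codRestrict _ (cechUnit_mem_ker x M)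

theorem cechElem_pow_mem (σ : Fin 1 ↪o Fin k) (n : ℕ) : cechElem x σ ^ n ∈ idealOf x ^ n := by
  have h : cechElem x σ ∈ Set.range x := ⟨σ 0, by simp [cechElem]⟩
  exact Ideal.pow_mem_pow (Ideal.subset_span h) n

/-- The inverse of the `n`-th power of `r` in `R_r`. -/
def invPow (r : R) (n : ℕ) : Localization.Away r := Localization.mk 1 ⟨r ^ n, n, rfl⟩

theorem pow_smul_invPow_add (r : R) (n m : ℕ) : r ^ m • invPow r (m + n) = invPow r n := by
  rw [invPow, invPow, Localization.smul_mk, Localization.mk_eq_mk_iff, Localization.r_iff_exists]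
  refine ⟨1, ?_⟩
  simp only [OneMemClass.coe_one, one_mul, smul_eq_mul, mul_one, pow_add]
  ring

theorem pow_smul_invPow (r : R) (n : ℕ) : r ^ n • invPow r n = 1 := by
  have h := pow_smul_invPow_add r 0 n
  rw [add_zero] at h
  rw [h, invPow]
  exact (congrArg (Localization.mk 1) (Subtype.ext (pow_zero r))).trans Localization.mk_one

/-- The map `Hom_R(a ^ n, M) → ⨁ M_{x_i}`, `g ↦ (g(x_i ^ n) / x_i ^ n)_i`. -/
def transformToCechAux (n : ℕ) :
    (↥(idealOf x ^ n) →ₗ[R] M) →ₗ[R] CechTerm x 1 ⊗[R] M :=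
  ∑ σ : Fin 1 ↪o Fin k,
    TensorProduct.mk R (CechTerm x 1) M (Pi.single σ (invPow (cechElem x σ) n)) ∘ₗ
      LinearMap.applyₗ (⟨cechElem x σ ^ n, cechElem_pow_mem x σ n⟩ : ↥(idealOf x ^ n))

theorem transformToCechAux_apply (n : ℕ) (g : ↥(idealOf x ^ n) →ₗ[R] M) :
    transformToCechAux x M n g = ∑ σ : Fin 1 ↪o Fin k,
      Pi.single (M := fun σ : Fin 1 ↪o Fin k => Localization.Away (cechElem x σ)) σ
        (invPow (cechElem x σ) n) ⊗ₜ[R]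
        g ⟨cechElem x σ ^ n, cechElem_pow_mem x σ n⟩ := by
  simp [transformToCechAux, LinearMap.sum_apply]

theorem transformToCechAux_restrict (n m : ℕ) (h : n ≤ m) (g : ↥(idealOf x ^ n) →ₗ[R] M) :
    transformToCechAux x M m (restrictPow (idealOf x) M n m h g) =
      transformToCechAux x M n g := by
  obtain ⟨l, rfl⟩ := Nat.exists_eq_add_of_le' h
  rw [transformToCechAux_apply, transformToCechAux_apply]
  refine Finset.sum_congr rfl fun σ _ => ?_
  have hg : restrictPow (idealOf x) M n (l + n) h g
      ⟨cechElem x σ ^ (l + n), cechElem_pow_mem x σ (l + n)⟩ =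
      cechElem x σ ^ l • g ⟨cechElem x σ ^ n, cechElem_pow_mem x σ n⟩ := by
    rw [← map_smul]
    refine congrArg g (Subtype.ext ?_)
    simp [pow_add]
  rw [hg, ← TensorProduct.smul_tmul, ← Pi.single_smul, pow_smul_invPow_add]

theorem cechTensor_ext (p : ℕ) (c : CechTerm x p ⊗[R] M)
    (h : ∀ σ, (LinearMap.proj σ : CechTerm x p →ₗ[R] Localization.Away (cechElem x σ)).rTensor M c
      = 0) : c = 0 := by
  apply (TensorProduct.piLeft R M
    (fun σ : Fin p ↪o Fin k => Localization.Away (cechElem x σ))).injective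
  rw [map_zero]
  funext σ
  rw [Pi.zero_apply, ← h σ]
  clear h
  induction c using TensorProduct.induction_on with
  | zero => simp
  | tmul c m => simp
  | add c c' hc hc' => rw [map_add, map_add, Pi.add_apply, hc, hc']

theorem transformToCechAux_cocycle (n : ℕ) (g : ↥(idealOf x ^ n) →ₗ[R] M) :
    (cechD x 1).rTensor M (transformToCechAux x M n g) = 0 := by
  refine cechTensor_ext x M 2 _ fun σ => ?_
  have h1 : (LinearMap.proj σ : CechTerm x 2 →ₗ[R] Localization.Away (cechElem x σ)).rTensor M
      ((cechD x 1).rTensor M (transformToCechAux x M n g)) =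
      ∑ j : Fin 2, ((-1 : R) ^ (j : ℕ)) • (cechFace x σ j (invPow (cechElem x (face σ j)) n) ⊗ₜ[R]
        g ⟨cechElem x (face σ j) ^ n, cechElem_pow_mem x (face σ j) n⟩) := by
    simp only [transformToCechAux_apply, map_sum, LinearMap.rTensor_tmul, LinearMap.proj_apply,
      cechD_apply, TensorProduct.sum_tmul, TensorProduct.smul_tmul']
    rw [Finset.sum_comm]
    refine Finset.sum_congr rfl fun j _ => ?_
    rw [Finset.sum_eq_single (face σ j)]
    · rw [Pi.single_eq_same]
    · intro τ _ hτ
      rw [Pi.single_eq_of_ne hτ.symm, map_zero, smul_zero, TensorProduct.zero_tmul]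
    · simp
  have h2 : ∀ j, cechElem x (face σ j) ^ n • cechFace x σ j (invPow (cechElem x (face σ j)) n)
      = 1 := fun j => by rw [← map_smul, pow_smul_invPow, map_one]
  rw [h1, Fin.sum_univ_two]
  have h3 : ∀ (r s : R) (hr : r ∈ idealOf x ^ n) (hs : s ∈ idealOf x ^ n)
      (u v : Localization.Away (cechElem x σ)), r • u = 1 → s • v = 1 →
      u ⊗ₜ[R] g ⟨r, hr⟩ = v ⊗ₜ[R] g ⟨s, hs⟩ := by
    intro r s hr hs u v hu hv
    have e1 : u = s • (u * v) := by rw [← mul_smul_comm, hv, mul_one]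
    have e2 : v = r • (u * v) := by rw [← smul_mul_assoc, hu, one_mul]
    have e3 : s • g ⟨r, hr⟩ = r • g ⟨s, hs⟩ := by
      rw [← map_smul, ← map_smul]
      exact congrArg g (Subtype.ext (mul_comm s r))
    calc u ⊗ₜ[R] g ⟨r, hr⟩ = (s • (u * v)) ⊗ₜ[R] g ⟨r, hr⟩ := by rw [← e1]
      _ = (u * v) ⊗ₜ[R] (r • g ⟨s, hs⟩) := by rw [TensorProduct.smul_tmul, e3]
      _ = (r • (u * v)) ⊗ₜ[R] g ⟨s, hs⟩ := by rw [TensorProduct.smul_tmul]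
      _ = v ⊗ₜ[R] g ⟨s, hs⟩ := by rw [← e2]
  rw [h3 _ _ (cechElem_pow_mem x (face σ 0) n) (cechElem_pow_mem x (face σ 1) n) _ _ (h2 0) (h2 1),
    Fin.val_zero, Fin.val_one, pow_zero, pow_one, ← add_smul, add_neg_cancel, zero_smul]

/-- The natural map `D_a(M) → ⨁ M_{x_i}`, which sends the class of `g : a ^ n → M` to
`(g(x_i ^ n) / x_i ^ n)_i`. -/
def transformToCech : IdealTransform (idealOf x) M →ₗ[R] CechTerm x 1 ⊗[R] M :=
  Module.DirectLimit.lift R ℕ _ _ (transformToCechAux x M) (transformToCechAux_restrict x M)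

theorem transformToCech_cocycle (f : IdealTransform (idealOf x) M) :
    transformToCech x M f ∈ LinearMap.ker ((cechD x 1).rTensor M) := by
  obtain ⟨n, g, rfl⟩ := Module.DirectLimit.exists_of f
  rw [transformToCech, Module.DirectLimit.lift_of]
  exact transformToCechAux_cocycle x M n g

/-- The natural map `ρ_M : D_a(M) → H^1(Ď_x ⊗ M)`. -/
def transformToGlobalCech :
    IdealTransform (idealOf x) M →ₗ[R] (globalCechTensor M x).homology 1 :=
  globalCechClass x M ∘ₗ (transformToCech x M).codRestrict _ (transformToCech_cocycle x M)

variable {M}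

theorem cechUnit_naturality {N : Type u} [AddCommGroup N] [Module R N] (f : M →ₗ[R] N) (m : M) :
    f.lTensor (CechTerm x 1) (cechUnit x M m) = cechUnit x N (f m) := by
  simp [cechUnit]

theorem cechD_naturality {N : Type u} [AddCommGroup N] [Module R N] (f : M →ₗ[R] N) (p : ℕ)
    (c : CechTerm x p ⊗[R] M) :
    f.lTensor (CechTerm x (p + 1)) ((cechD x p).rTensor M c) =
      (cechD x p).rTensor N (f.lTensor (CechTerm x p) c) := by
  rw [← LinearMap.comp_apply, ← LinearMap.comp_apply, LinearMap.lTensor_comp_rTensor,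
    LinearMap.rTensor_comp_lTensor]

theorem cechUnit_eq_zero {m : M} (hm : m ∈ torsionSubmodule (idealOf x) M) :
    cechUnit x M m = 0 := by
  obtain ⟨n, hn⟩ := hm
  have h : ∀ c : CechTerm x 1, c ⊗ₜ[R] m = 0 := by
    intro c
    refine cechTensor_ext x M 1 _ fun σ => ?_
    rw [LinearMap.rTensor_tmul, LinearMap.proj_apply]
    have hc : c σ = cechElem x σ ^ n • (invPow (cechElem x σ) n * c σ) := by
      rw [← smul_mul_assoc, pow_smul_invPow, one_mul]
    rw [hc, TensorProduct.smul_tmul, hn _ (cechElem_pow_mem x σ n), TensorProduct.tmul_zero]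
  exact h _

instance (p : ℕ) : Module.Flat R (CechTerm x p) :=
  have : ∀ σ : Fin p ↪o Fin k, Module.Flat R (Localization.Away (cechElem x σ)) :=
    fun σ => IsLocalization.flat _ (Submonoid.powers (cechElem x σ))
  Module.Flat.of_linearEquiv (DirectSum.linearEquivFunOnFintype R (Fin p ↪o Fin k)
    (fun σ => Localization.Away (cechElem x σ))).symm

/-! Let `0 → M → N → P` be exact. If `y ∈ N` is mapped to an `a`-torsion element of `P`, then
`d^0(1 ⊗ y) = (y / 1)_i` comes from a unique element of `Č_x^1 ⊗ M`, and this element is a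
cocycle. -/

section Connecting

variable {N P : Type u} [AddCommGroup N] [Module R N] [AddCommGroup P] [Module R P]
  (f : M →ₗ[R] N) (g : N →ₗ[R] P)

theorem exists_unique_cocycle (hf : Function.Injective f) (hfg : Function.Exact f g) {y : N}
    (hy : g y ∈ torsionSubmodule (idealOf x) P) :
    ∃! c : CechTerm x 1 ⊗[R] M, f.lTensor (CechTerm x 1) c = cechUnit x N y := by
  have hinj := Module.Flat.lTensor_preserves_injective_linearMap (M := CechTerm x 1) f hf
  obtain ⟨c, hc⟩ := (Module.Flat.lTensor_exact (CechTerm x 1) hfg (cechUnit x N y)).1 (by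
    rw [cechUnit_naturality, cechUnit_eq_zero x hy])
  exact ⟨c, hc, fun c' hc' => hinj (hc'.trans hc.symm)⟩

theorem cocycle_of_lTensor_eq (hf : Function.Injective f) {y : N} {c : CechTerm x 1 ⊗[R] M}
    (hc : f.lTensor (CechTerm x 1) c = cechUnit x N y) :
    c ∈ LinearMap.ker ((cechD x 1).rTensor M) := by
  have hinj := Module.Flat.lTensor_preserves_injective_linearMap (M := CechTerm x (1 + 1)) f hf
  apply hinj
  rw [cechD_naturality, hc, map_zero]
  exact cechD_rTensor_cechD_rTensor x N 0 (1 ⊗ₜ[R] y)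

/-- The map that sends `y ∈ N` with `a`-torsion image in `P` to the class in `H^1(Č_x ⊗ M)` of
the cocycle `c` in `Č_x^1 ⊗ M` whose image in `Č_x^1 ⊗ N` is `d^0(1 ⊗ y)`. -/
def connecting (hf : Function.Injective f) (hfg : Function.Exact f g) :
    (torsionSubmodule (idealOf x) P).comap g →ₗ[R] (cechTensor M x).homology 1 :=
  cechClass x M ∘ₗ
    { toFun := fun y => ⟨(exists_unique_cocycle x f g hf hfg y.2).choose,
        cocycle_of_lTensor_eq x f hf (exists_unique_cocycle x f g hf hfg y.2).choose_spec.1⟩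
      map_add' := fun y y' => Subtype.ext
        (((exists_unique_cocycle x f g hf hfg (y + y').2).choose_spec.2 _ (by
          simp only [Submodule.coe_add, map_add]
          rw [(exists_unique_cocycle x f g hf hfg y.2).choose_spec.1,
            (exists_unique_cocycle x f g hf hfg y'.2).choose_spec.1])).symm)
      map_smul' := fun r y => Subtype.ext
        (((exists_unique_cocycle x f g hf hfg (r • y).2).choose_spec.2 _ (by
          simp only [Submodule.coe_smul, map_smul, RingHom.id_apply]
          rw [(exists_unique_cocycle x f g hf hfg y.2).choose_spec.1])).symm) }

theorem connecting_apply (hf : Function.Injective f) (hfg : Function.Exact f g)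
    (y : (torsionSubmodule (idealOf x) P).comap g) (c : LinearMap.ker ((cechD x 1).rTensor M))
    (hc : f.lTensor (CechTerm x 1) c = cechUnit x N y) :
    connecting x f g hf hfg y = cechClass x M c :=
  congrArg (cechClass x M) (Subtype.ext
    ((exists_unique_cocycle x f g hf hfg y.2).choose_spec.2 _ hc).symm)

end Connecting

/-! The natural map `H^1_a(M) → H^1(Č_x ⊗ M)`. Let `I^•` be an injective resolution of `M`. The
inclusions `Γ_a(I^q) ⊆ I^q ≅ Č_x^0 ⊗ I^q` define a map from `Γ_a(I^•)` to the total complex of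
`Č_x ⊗ I^•`, and the map from `Č_x ⊗ M` to this total complex is a quasi-isomorphism. In degree
`1` this means: a cocycle `z = d y` of `Γ_a(I^•)`, with `y ∈ I^0`, is cohomologous, up to the
sign which is customary for connecting homomorphisms, to the image of `1 ⊗ y` under the Čech
differential, and the latter comes from a unique cocycle of `Č_x ⊗ M`. -/

section NaturalMap

variable (I : InjectiveResolution (ModuleCat.of R M))

/-- The embedding `M → I^0`. -/
def resolutionUnit : M →ₗ[R] I.cocomplex.X 0 :=
  ((HomologicalComplex.singleObjXSelf (ComplexShape.up ℕ) 0 (ModuleCat.of R M)).inv ≫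
    I.ι.f 0).hom

theorem resolutionUnit_injective : Function.Injective (resolutionUnit I) :=
  (ModuleCat.mono_iff_injective _).1 inferInstance

theorem resolutionUnit_exact :
    Function.Exact (resolutionUnit I) (I.cocomplex.d 0 1).hom := by
  have h := (ShortComplex.ShortExact.moduleCat_exact_iff_function_exact _).1 I.exact₀
  intro y
  refine (h y).trans ⟨?_, ?_⟩
  · rintro ⟨m, hm⟩
    exact ⟨m, hm⟩
  · rintro ⟨m, hm⟩
    exact ⟨m, hm⟩

/-- The complex `Γ_a(I^•)`. -/
abbrev torsionComplex (a : Ideal R) : CochainComplex (ModuleCat.{u} R) ℕ :=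
  ((torsionFunctor a).mapHomologicalComplex (ComplexShape.up ℕ)).obj I.cocomplex

/-- The elements of `I^0` whose differential is `a`-torsion. -/
abbrev preTorsion (a : Ideal R) : Submodule R (I.cocomplex.X 0) :=
  (torsionSubmodule a (I.cocomplex.X 1)).comap (I.cocomplex.d 0 1).hom

/-- The map that sends `y ∈ I^0` with `d y ∈ Γ_a(I^1)` to the class of `d y` in
`H^1(Γ_a(I^•))`. -/
def resolutionClass (a : Ideal R) :
    preTorsion I a →ₗ[R] (torsionComplex I a).homology 1 :=
  cohomologyClass (torsionComplex I a) 1 ∘ₗ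
    ((I.cocomplex.d 0 1).hom.restrict (p := preTorsion I a)
      (q := torsionSubmodule a (I.cocomplex.X 1)) (fun _ hy => hy)).codRestrict
        (LinearMap.ker ((torsionComplex I a).d 1 (1 + 1)).hom) (fun y => Subtype.ext
          (congrArg (fun f => f.hom y.1) (I.cocomplex.d_comp_d 0 1 (1 + 1))))

theorem resolutionClass_surjective (a : Ideal R) :
    Function.Surjective (resolutionClass I a) := by
  intro c
  obtain ⟨z, rfl⟩ := cohomologyClass_surjective (torsionComplex I a) 1 c
  have h := (ShortComplex.ShortExact.moduleCat_exact_iff_function_exact _).1 (I.exact_succ 0)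
  have hz : (I.cocomplex.d 1 (1 + 1)).hom z.1.1 = 0 := congrArg Subtype.val z.2
  obtain ⟨y, hy⟩ := (h z.1.1).1 hz
  have hy' : (I.cocomplex.d 0 1).hom y = z.1.1 := hy
  have hy'' : (I.cocomplex.d 0 1).hom y ∈ torsionSubmodule a (I.cocomplex.X 1) := by
    rw [hy']
    exact z.1.2
  refine ⟨⟨y, hy''⟩, ?_⟩
  exact congrArg (cohomologyClass (torsionComplex I a) 1) (Subtype.ext (Subtype.ext hy'))

theorem ker_resolutionClass_le :
    LinearMap.ker (resolutionClass I (idealOf x)) ≤ LinearMap.ker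
      (connecting x (resolutionUnit I) (I.cocomplex.d 0 1).hom (resolutionUnit_injective I)
        (resolutionUnit_exact I)) := by
  intro y hy
  obtain ⟨w, hw⟩ := (cohomologyClass_eq_zero_iff (torsionComplex I (idealOf x)) 0 _).1 hy
  have hw' : (I.cocomplex.d 0 1).hom w.1 = (I.cocomplex.d 0 1).hom y.1 := congrArg Subtype.val hw
  have h0 : (I.cocomplex.d 0 1).hom (y.1 - w.1) = 0 := by rw [map_sub, hw', sub_self]
  obtain ⟨m, hm⟩ := (resolutionUnit_exact I _).1 h0
  have hc : (resolutionUnit I).lTensor (CechTerm x 1) (cechUnit x M m) =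
      cechUnit x (I.cocomplex.X 0) y.1 := by
    rw [cechUnit_naturality, hm, map_sub, cechUnit_eq_zero x w.2, sub_zero]
  rw [LinearMap.mem_ker, connecting_apply x _ _ _ _ y
    ⟨cechUnit x M m, cechUnit_mem_ker x M m⟩ hc]
  refine (cohomologyClass_eq_zero_iff (cechTensor M x) 0 _).2
    ⟨(1 : CechTerm x 0) ⊗ₜ[R] m, ?_⟩
  exact cechTensor_d_apply x M 0 (1 ⊗ₜ[R] m)

/-- The natural map `H^1(Γ_a(I^•)) → H^1(Č_x ⊗ M)`: it sends the class of `d y`, for `y ∈ I^0`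
with `d y ∈ Γ_a(I^1)`, to the class of the cocycle `c` in `Č_x^1 ⊗ M` whose image in
`Č_x^1 ⊗ I^0` is `d^0(1 ⊗ y)`. -/
def resolutionToCech :
    (torsionComplex I (idealOf x)).homology 1 →ₗ[R] (cechTensor M x).homology 1 :=
  (LinearMap.ker (resolutionClass I (idealOf x))).liftQ
      (connecting x (resolutionUnit I) (I.cocomplex.d 0 1).hom (resolutionUnit_injective I)
        (resolutionUnit_exact I)) (ker_resolutionClass_le x I) ∘ₗ
    ((resolutionClass I (idealOf x)).quotKerEquivOfSurjective
      (resolutionClass_surjective I (idealOf x))).symm.toLinearMap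

theorem resolutionToCech_apply (y : preTorsion I (idealOf x))
    (c : LinearMap.ker ((cechD x 1).rTensor M))
    (hc : (resolutionUnit I).lTensor (CechTerm x 1) c = cechUnit x (I.cocomplex.X 0) y) :
    resolutionToCech x I (resolutionClass I (idealOf x) y) = cechClass x M c := by
  have h : ((resolutionClass I (idealOf x)).quotKerEquivOfSurjective
      (resolutionClass_surjective I (idealOf x))).symm (resolutionClass I (idealOf x) y) =
      Submodule.Quotient.mk y := by
    rw [LinearEquiv.symm_apply_eq]
    rfl
  rw [resolutionToCech, LinearMap.comp_apply, LinearEquiv.coe_coe, h]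
  exact connecting_apply x _ _ (resolutionUnit_injective I) (resolutionUnit_exact I) y c hc

theorem resolutionClass_eq (a : Ideal R) (n : ℕ) (y y' : preTorsion I a)
    (h : ∀ r ∈ a ^ n, r • (y : I.cocomplex.X 0) = r • (y' : I.cocomplex.X 0)) :
    resolutionClass I a y = resolutionClass I a y' := by
  rw [← sub_eq_zero, ← map_sub]
  refine (cohomologyClass_eq_zero_iff (torsionComplex I a) 0 _).2
    ⟨⟨(y - y' : preTorsion I a).1, n, fun r hr => ?_⟩, rfl⟩
  rw [Submodule.coe_sub, smul_sub, h r hr, sub_self]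

theorem exists_extension (a : Ideal R) (n : ℕ) (g : ↥(a ^ n) →ₗ[R] M) :
    ∃ y : preTorsion I a, ∀ r : ↥(a ^ n), r.1 • (y : I.cocomplex.X 0) = resolutionUnit I (g r) := by
  have : Mono (ModuleCat.ofHom (a ^ n).subtype) :=
    (ModuleCat.mono_iff_injective _).2 (Submodule.subtype_injective _)
  have : Injective (ModuleCat.of R (I.cocomplex.X 0)) := I.injective 0
  have hG := Injective.comp_factorThru (ModuleCat.ofHom (resolutionUnit I ∘ₗ g))
    (ModuleCat.ofHom (a ^ n).subtype)
  set G := Injective.factorThru (ModuleCat.ofHom (resolutionUnit I ∘ₗ g))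
    (ModuleCat.ofHom (a ^ n).subtype)
  have h : ∀ r : ↥(a ^ n), r.1 • G.hom (1 : R) = resolutionUnit I (g r) := by
    intro r
    rw [← map_smul, smul_eq_mul, mul_one]
    exact congrArg (fun f => f.hom r) hG
  refine ⟨⟨G.hom (1 : R), n, fun r hr => ?_⟩, h⟩
  rw [← map_smul, h ⟨r, hr⟩]
  exact (resolutionUnit_exact I).apply_apply_eq_zero _

/-- The map `Hom_R(a ^ n, M) → H^1(Γ_a(I^•))` that sends `g` to the class of `d y`, where `y ∈ I^0`
is such that `g` is multiplication by `y`, that is, `r ↦ r • y` extends `g` to `R → I^0`. -/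
def homToResolution (a : Ideal R) (n : ℕ) :
    (↥(a ^ n) →ₗ[R] M) →ₗ[R] (torsionComplex I a).homology 1 where
  toFun g := resolutionClass I a (exists_extension I a n g).choose
  map_add' g g' := by
    rw [← map_add]
    refine resolutionClass_eq I a n _ _ fun r hr => ?_
    rw [(exists_extension I a n (g + g')).choose_spec ⟨r, hr⟩, Submodule.coe_add, smul_add,
      (exists_extension I a n g).choose_spec ⟨r, hr⟩,
      (exists_extension I a n g').choose_spec ⟨r, hr⟩, LinearMap.add_apply, map_add]
  map_smul' c g := by
    rw [← map_smul]
    refine resolutionClass_eq I a n _ _ fun r hr => ?_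
    rw [(exists_extension I a n (c • g)).choose_spec ⟨r, hr⟩, Submodule.coe_smul, smul_comm,
      (exists_extension I a n g).choose_spec ⟨r, hr⟩, LinearMap.smul_apply, map_smul,
      RingHom.id_apply]

theorem homToResolution_apply (a : Ideal R) (n : ℕ) (g : ↥(a ^ n) →ₗ[R] M) (y : preTorsion I a)
    (hy : ∀ r : ↥(a ^ n), r.1 • (y : I.cocomplex.X 0) = resolutionUnit I (g r)) :
    homToResolution I a n g = resolutionClass I a y :=
  resolutionClass_eq I a n _ _ fun r hr =>
    ((exists_extension I a n g).choose_spec ⟨r, hr⟩).trans (hy ⟨r, hr⟩).symm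

/-- The natural map `D_a(M) → H^1(Γ_a(I^•))`, the direct limit of the connecting maps
`Hom_R(a ^ n, M) → Ext^1_R(R / a ^ n, M)`. -/
def transformToResolution (a : Ideal R) :
    IdealTransform a M →ₗ[R] (torsionComplex I a).homology 1 :=
  Module.DirectLimit.lift R ℕ _ _ (homToResolution I a) (fun n m h g => by
    rw [homToResolution_apply I a m _ (exists_extension I a n g).choose]
    · rfl
    · intro r
      exact (exists_extension I a n g).choose_spec ⟨r.1, Ideal.pow_le_pow_right h r.2⟩)

end NaturalMap

variable (M) in
/-- The natural map `H^1_a(M) → H^1(Č_x ⊗ M)`. -/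
def localCohomologyToCech :
    LocalCohomology (idealOf x) 1 M →ₗ[R] (cechTensor M x).homology 1 :=
  resolutionToCech x (injectiveResolution (ModuleCat.of R M)) ∘ₗ
    ((InjectiveResolution.isoRightDerivedObj (injectiveResolution (ModuleCat.of R M))
      (torsionFunctor (idealOf x)) 1).hom).hom

variable (M) in
/-- The natural map `D_a(M) → H^1_a(M)`. -/
def transformToLocalCohomology (a : Ideal R) : IdealTransform a M →ₗ[R] LocalCohomology a 1 M :=
  ((InjectiveResolution.isoRightDerivedObj (injectiveResolution (ModuleCat.of R M))
      (torsionFunctor a) 1).inv).hom ∘ₗ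
    transformToResolution (injectiveResolution (ModuleCat.of R M)) a

end Maps

end CechTransform

end

open CechTransform

/-! Everything is read off from 1-cocycles of `Č_x ⊗ M`, that is, compatible families in `⨁
M_{x_i}`. Since `Ď_x` vanishes in degree 0 and agrees with `Č_x` above it, `H^1(Ď_x ⊗ M)` is the
module of these cocycles itself (`globalCechClass_injective`, `globalCechClass_surjective`).
`H^1(Č_x ⊗ M)` is its quotient by the families `(m/1)_i`. This gives the lower row.

Injectivity on the torsion side rests on one fact: an ideal containing a power of every `x_i`
contains a power of `a` (`exists_idealOf_pow_le`). Applied to annihilators, it shows that `(m/1)_i =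
0` exactly for torsion `m`. Applied to the kernel of `g : a ^ n → M`, it shows that `ρ_M` is
injective.

For `H^1_a(M)`, take an injective resolution `I` of `M`, and `y ∈ I^0` with `d y` torsion. If its
Čech cocycle is some `(m/1)_i`, then `y - m` is torsion and `d y = d (y - m)` is a boundary in
`Γ_a(I)`; hence the map to `H^1(Č_x ⊗ M)` is injective. If `a ^ n` kills `d y`, then `r ↦ r y` maps
`a ^ n` into `M`, so `D_a(M)` surjects onto `H^1_a(M)`. Exactness of the upper row at `D_a(M)` then
follows from the lower row and the two injective vertical maps.

For Deligne's formula, write a cocycle as `(m_i / x_i ^ n)_i` with `x_j ^ n m_i = x_i ^ n m_j`. Then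
`e_i ↦ m_i` kills the Koszul boundaries of `x ^ n`. For `m` large, pro-vanishing of `H_1` turns
relations among the `x_i ^ m` into such boundaries after `e_i` is scaled by `x_i ^ (m - n)`. So `x_i
^ m ↦ x_i ^ (m - n) m_i` is well defined on the ideal of the `x_i ^ m`, which contains a power of
`a`, and gives a preimage in `D_a(M)`. -/

namespace CechTransform

open TensorProduct

/-! ### Fractions in `R_r ⊗ M`. -/

section LocalizedTensor

variable {R : Type u} [CommRing R] {M : Type u} [AddCommGroup M] [Module R M]

theorem one_tmul_eq_zero_iff (r : R) (m : M) :
    (1 : Localization.Away r) ⊗ₜ[R] m = 0 ↔ ∃ n : ℕ, r ^ n • m = 0 := by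
  have h := IsLocalizedModule.eq_zero_iff (Submonoid.powers r)
    (TensorProduct.mk R (Localization.Away r) M 1) (m := m)
  refine h.trans ⟨?_, ?_⟩
  · rintro ⟨⟨_, n, rfl⟩, hs⟩
    exact ⟨n, hs⟩
  · rintro ⟨n, hn⟩
    exact ⟨⟨_, n, rfl⟩, hn⟩

theorem invPow_tmul_pow_smul (r : R) (n l : ℕ) (m : M) :
    invPow r (l + n) ⊗ₜ[R] (r ^ l • m) = invPow r n ⊗ₜ[R] m := by
  rw [← TensorProduct.smul_tmul, pow_smul_invPow_add]

theorem exists_eq_invPow_tmul (r : R) (z : Localization.Away r ⊗[R] M) :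
    ∃ (n : ℕ) (m : M), z = invPow r n ⊗ₜ[R] m := by
  obtain ⟨⟨m, ⟨_, n, rfl⟩⟩, h⟩ := IsLocalizedModule.surj (Submonoid.powers r)
    (TensorProduct.mk R (Localization.Away r) M 1) z
  have h' : r ^ n • z = 1 ⊗ₜ[R] m := h
  refine ⟨n, m, ?_⟩
  rw [← one_smul (Localization.Away r) z, ← pow_smul_invPow r n, smul_assoc,
    smul_comm, h', TensorProduct.smul_tmul', smul_eq_mul, mul_one]

theorem invPow_tmul_eq_zero_iff (r : R) (n : ℕ) (m : M) :
    invPow r n ⊗ₜ[R] m = 0 ↔ ∃ l : ℕ, r ^ l • m = 0 := by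
  rw [← one_tmul_eq_zero_iff]
  refine ⟨fun h => ?_, fun h => ?_⟩
  · rw [← pow_smul_invPow r n, ← TensorProduct.smul_tmul', h, smul_zero]
  · rw [← mul_one (invPow r n), ← smul_eq_mul, ← TensorProduct.smul_tmul', h, smul_zero]

end LocalizedTensor

/-! ### Čech 1-cochains by components, torsion, and injectivity of `D_a(M) → ⨁ M_{x_i}`. -/

section Components

variable {R : Type u} [CommRing R] {k : ℕ} (x : Fin k → R)
  (M : Type u) [AddCommGroup M] [Module R M]

/-- The projection `Č_x^p ⊗ M → R_{x_{σ 0} ⋯ x_{σ (p - 1)}} ⊗ M`. -/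
abbrev cechProj {p : ℕ} (σ : Fin p ↪o Fin k) :
    CechTerm x p ⊗[R] M →ₗ[R] Localization.Away (cechElem x σ) ⊗[R] M :=
  (LinearMap.proj σ : CechTerm x p →ₗ[R] Localization.Away (cechElem x σ)).rTensor M

theorem cechTensor_ext_iff {p : ℕ} {c c' : CechTerm x p ⊗[R] M} :
    c = c' ↔ ∀ σ, cechProj x M σ c = cechProj x M σ c' := by
  refine ⟨fun h σ => h ▸ rfl, fun h => ?_⟩
  rw [← sub_eq_zero]
  refine cechTensor_ext x M p _ fun σ => ?_
  rw [map_sub, sub_eq_zero]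
  exact h σ

/-- With this, the component formula and the compatibility with restriction proved for
`transformToCechAux` also serve for `cechUnit`. -/
theorem cechUnit_eq_transformToCechAux (m : M) :
    cechUnit x M m = transformToCechAux x M 0
      ((LinearMap.toSpanSingleton R M m) ∘ₗ (idealOf x ^ 0).subtype) := by
  have h1 : cechD x 0 1 = ∑ σ : Fin 1 ↪o Fin k,
      Pi.single (M := fun σ : Fin 1 ↪o Fin k => Localization.Away (cechElem x σ)) σ
        (invPow (cechElem x σ) 0) := by
    funext σ
    rw [Finset.sum_apply, Finset.sum_eq_single σ]
    · have h := pow_smul_invPow (cechElem x σ) 0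
      rw [pow_zero, one_smul] at h
      simp [cechD_apply, h]
    · intro τ _ hτ
      rw [Pi.single_eq_of_ne hτ.symm]
    · simp
  rw [transformToCechAux_apply, cechUnit]
  simp [h1, TensorProduct.sum_tmul]

theorem cechProj_transformToCechAux (n : ℕ) (g : ↥(idealOf x ^ n) →ₗ[R] M)
    (σ : Fin 1 ↪o Fin k) :
    cechProj x M σ (transformToCechAux x M n g) =
      invPow (cechElem x σ) n ⊗ₜ[R] g ⟨cechElem x σ ^ n, cechElem_pow_mem x σ n⟩ := by
  rw [transformToCechAux_apply, map_sum, Finset.sum_eq_single σ]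
  · simp
  · intro τ _ hτ
    simp [Pi.single_eq_of_ne hτ.symm]
  · simp

theorem cechProj_cechUnit (m : M) (σ : Fin 1 ↪o Fin k) :
    cechProj x M σ (cechUnit x M m) = 1 ⊗ₜ[R] m := by
  have h := pow_smul_invPow (cechElem x σ) 0
  rw [pow_zero, one_smul] at h
  rw [cechUnit_eq_transformToCechAux, cechProj_transformToCechAux, h]
  simp

theorem exists_cechElem_eq (i : Fin k) : ∃ σ : Fin 1 ↪o Fin k, cechElem x σ = x i :=
  ⟨OrderEmbedding.ofStrictMono (fun _ => i) (fun a b h => absurd h (by simp [Subsingleton.elim a b])),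
    by simp only [cechElem, Fin.prod_univ_one]; rfl⟩

-- The finiteness of the sequence enters here: `a` is finitely generated and lies in the radical of
-- `J`. The lemma is applied to annihilators of elements, to kernels of maps on `a ^ n`, and to the
-- ideal of the `x_i ^ m`.
variable {x} in
theorem exists_idealOf_pow_le {J : Ideal R}
    (h : ∀ σ : Fin 1 ↪o Fin k, ∃ n : ℕ, cechElem x σ ^ n ∈ J) : ∃ n : ℕ, idealOf x ^ n ≤ J := by
  refine Ideal.exists_pow_le_of_le_radical_of_fg (Ideal.span_le.2 ?_)
    ⟨(Set.finite_range x).toFinset, by simp⟩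
  rintro _ ⟨i, rfl⟩
  obtain ⟨σ, hσ⟩ := exists_cechElem_eq x i
  rw [← hσ]
  exact h σ

theorem cechUnit_eq_zero_iff (m : M) :
    cechUnit x M m = 0 ↔ m ∈ torsionSubmodule (idealOf x) M := by
  refine ⟨fun h => ?_, cechUnit_eq_zero x⟩
  obtain ⟨n, hn⟩ := exists_idealOf_pow_le (x := x) (J := Ideal.torsionOf R M m) fun σ => by
    have h1 := cechProj_cechUnit x M m σ
    rw [h, map_zero] at h1
    obtain ⟨l, hl⟩ := (one_tmul_eq_zero_iff _ _).1 h1.symm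
    exact ⟨l, hl⟩
  exact ⟨n, fun r hr => hn hr⟩

theorem transformToCech_of (n : ℕ) (g : ↥(idealOf x ^ n) →ₗ[R] M) :
    transformToCech x M (IdealTransform.of (idealOf x) M n g) = transformToCechAux x M n g :=
  Module.DirectLimit.lift_of _ _ _

theorem transformToCech_injective : Function.Injective (transformToCech x M) := by
  refine (injective_iff_map_eq_zero _).2 fun f hf => ?_
  obtain ⟨n, g, rfl⟩ := Module.DirectLimit.exists_of f
  rw [transformToCech_of] at hf
  obtain ⟨N, hN⟩ := exists_idealOf_pow_le (x := x)
    -- The kernel of `g`, seen as an ideal of `R`. Vanishing of `g(x_i ^ n) / x_i ^ n` gives `x_i ^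
    -- l g(x_i ^ n) = 0`, so `x_i ^ (l + n)` lies in it.
    (J := (LinearMap.ker g).map (idealOf x ^ n).subtype) fun σ => by
      have h1 := cechProj_transformToCechAux x M n g σ
      rw [hf, map_zero] at h1
      obtain ⟨l, hl⟩ := (invPow_tmul_eq_zero_iff _ _ _).1 h1.symm
      rw [← map_smul] at hl
      exact ⟨l + n, _, hl, by simp [pow_add]⟩
  -- Nothing forces `n ≤ N`; the exponent `N + n` allows both restricting `g` and using `hN`.
  have hle : n ≤ N + n := Nat.le_add_left _ _
  have h0 : restrictPow (idealOf x) M n (N + n) hle g = 0 := by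
    ext ⟨r, hr⟩
    obtain ⟨⟨s, hs⟩, hg, rfl⟩ := hN (Ideal.pow_le_pow_right (Nat.le_add_right _ _) hr)
    exact hg
  rw [← Module.DirectLimit.of_f (f := restrictPow (idealOf x) M) (hij := hle), h0, map_zero]

theorem cechUnit_eq_transformToCech (m : M) :
    cechUnit x M m = transformToCech x M (toIdealTransform (idealOf x) M m) := by
  rw [cechUnit_eq_transformToCechAux]
  exact (transformToCech_of x M 0 _).symm

end Components

end CechTransform

namespace CechTransform

open TensorProduct

/-! ### Čech cohomology in degrees 0 and 1, and the lower row. -/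

section CechCohomology

variable {R : Type u} [CommRing R] {k : ℕ} (x : Fin k → R)
  (M : Type u) [AddCommGroup M] [Module R M]

theorem cohomologyClass_naturality {K L : CochainComplex (ModuleCat.{u} R) ℕ} (φ : K ⟶ L) (n : ℕ)
    (z : LinearMap.ker (K.d n (n + 1)).hom) (w : LinearMap.ker (L.d n (n + 1)).hom)
    (h : (φ.f n).hom z = w) :
    (HomologicalComplex.homologyMap φ n).hom (cohomologyClass K n z) = cohomologyClass L n w := by
  set i := K.liftCycles (ModuleCat.ofHom (LinearMap.ker (K.d n (n + 1)).hom).subtype) (n + 1)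
    (by simp) (by ext z; exact z.2) with hi
  set j := L.liftCycles (ModuleCat.ofHom (LinearMap.ker (L.d n (n + 1)).hom).subtype) (n + 1)
    (by simp) (by ext z; exact z.2) with hj
  have hi' : i ≫ K.iCycles n = ModuleCat.ofHom (LinearMap.ker (K.d n (n + 1)).hom).subtype :=
    K.liftCycles_i _ _ _ _
  have hj' : j ≫ L.iCycles n = ModuleCat.ofHom (LinearMap.ker (L.d n (n + 1)).hom).subtype :=
    L.liftCycles_i _ _ _ _
  have h1 : (HomologicalComplex.cyclesMap φ n).hom (i.hom z) = j.hom w := by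
    -- Cycles of `L` embed into `L.X n`, where both sides are explicit.
    apply (ModuleCat.mono_iff_injective (L.iCycles n)).1 inferInstance
    refine (congrArg (fun f => f.hom (i.hom z)) (HomologicalComplex.cyclesMap_i φ n)).trans ?_
    refine (congrArg (φ.f n).hom (congrArg (fun f => f.hom z) hi')).trans ?_
    exact h.trans (congrArg (fun f => f.hom w) hj').symm
  refine (congrArg (fun f => f.hom (i.hom z)) (HomologicalComplex.homologyπ_naturality φ n)).trans ?_
  exact congrArg (L.homologyπ n).hom h1

theorem cechClass_surjective : Function.Surjective (cechClass x M) := by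
  intro c
  obtain ⟨z, rfl⟩ := cohomologyClass_surjective (cechTensor M x) 1 c
  exact ⟨⟨z.1, (cechTensor_d_apply x M 1 z.1).symm.trans z.2⟩, rfl⟩

theorem cechZero_one : cechZero x 1 = 1 := by
  funext σ
  rw [Subsingleton.elim σ default]
  exact map_one (IsLocalization.atUnit R
    (Localization.Away (cechElem x (default : Fin 0 ↪o Fin k))) (cechElem x default)
    (isUnit_cechElem_zero x default))

theorem exists_one_tmul_eq (c : CechTerm x 0 ⊗[R] M) : ∃ m : M, c = 1 ⊗ₜ[R] m := by
  obtain ⟨c, rfl⟩ := ((cechZero x).rTensor M).surjective c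
  refine ⟨TensorProduct.lid R M c, ?_⟩
  have h : c = 1 ⊗ₜ[R] TensorProduct.lid R M c := by
    rw [← TensorProduct.lid_symm_apply, LinearEquiv.symm_apply_apply]
  conv_lhs => rw [h]
  rw [← cechZero_one]
  rfl

/-- Every 0-cochain has the form `1 ⊗ m`, because `Č_x^0 ≅ R`. -/
theorem cechClass_eq_zero_iff (z : LinearMap.ker ((cechD x 1).rTensor M)) :
    cechClass x M z = 0 ↔ ∃ m, cechUnit x M m = z := by
  refine (cohomologyClass_eq_zero_iff (cechTensor M x) 0 _).trans ⟨?_, ?_⟩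
  · rintro ⟨w, hw⟩
    obtain ⟨m, rfl⟩ := exists_one_tmul_eq x M w
    exact ⟨m, (cechTensor_d_apply x M 0 _).symm.trans hw⟩
  · rintro ⟨m, hm⟩
    exact ⟨(1 : CechTerm x 0) ⊗ₜ[R] m, (cechTensor_d_apply x M 0 _).trans hm⟩

/-- Evaluation in degree 0 preserves kernels, and the augmentation is an isomorphism there. -/
theorem isZero_globalCechComplex_X_zero : Limits.IsZero ((globalCechComplex x).X 0) := by
  have : IsIso ((cechAugmentation x).f 0) := by
    have h : (cechAugmentation x).f 0 = ModuleCat.ofHom (cechZero x).symm.toLinearMap := by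
      exact CochainComplex.toSingle₀Equiv_symm_apply_f_zero _
    rw [h]
    exact (cechZero x).symm.toModuleIso.isIso_hom
  have : Mono ((HomologicalComplex.eval (ModuleCat.{u} R) (ComplexShape.up ℕ) 0).map
      (cechAugmentation x)) := inferInstanceAs (Mono ((cechAugmentation x).f 0))
  exact Limits.KernelFork.IsLimit.isZero_of_mono (Limits.KernelFork.mapIsLimit _
    (Limits.kernelIsKernel (cechAugmentation x))
    (HomologicalComplex.eval (ModuleCat.{u} R) (ComplexShape.up ℕ) 0))

theorem globalCechTensorInclusion_inv (z : CechTerm x 1 ⊗[R] M) :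
    ((globalCechTensorInclusion M x).f (0 + 1)).hom
      ((inv ((globalCechTensorInclusion M x).f (0 + 1))).hom z) = z :=
  congrArg (fun f => f.hom z) (IsIso.inv_hom_id ((globalCechTensorInclusion M x).f (0 + 1)))

theorem globalCechToCech_globalCechClass (z : LinearMap.ker ((cechD x 1).rTensor M)) :
    globalCechToCech x M (globalCechClass x M z) = cechClass x M z :=
  cohomologyClass_naturality (globalCechTensorInclusion M x) 1 _ _
    (globalCechTensorInclusion_inv x M z)

/-- There are no nonzero 1-coboundaries, since the term in degree 0 is zero. -/
theorem globalCechClass_injective : Function.Injective (globalCechClass x M) := by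
  refine (injective_iff_map_eq_zero _).2 fun z hz => ?_
  obtain ⟨w, hw⟩ := (cohomologyClass_eq_zero_iff (globalCechTensor M x) 0 _).1 hz
  have h0 : Limits.IsZero ((globalCechTensor M x).X 0) :=
    Functor.map_isZero (MonoidalCategory.tensorRight (ModuleCat.of R M))
      (isZero_globalCechComplex_X_zero x)
  have hd : (globalCechTensor M x).d 0 (0 + 1) = 0 := h0.eq_of_src _ _
  rw [hd] at hw
  refine Subtype.ext ((globalCechTensorInclusion_inv x M z).symm.trans ?_)
  exact (congrArg ((globalCechTensorInclusion M x).f (0 + 1)).hom hw.symm).trans (map_zero _)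

theorem globalCechClass_surjective : Function.Surjective (globalCechClass x M) := by
  intro c
  obtain ⟨z, rfl⟩ := cohomologyClass_surjective (globalCechTensor M x) 1 c
  have hz : (cechD x 1).rTensor M (((globalCechTensorInclusion M x).f 1).hom z.1) = 0 := by
    refine (cechTensor_d_apply x M 1 _).symm.trans ?_
    refine (congrArg (fun f => f.hom z.1) ((globalCechTensorInclusion M x).comm 1 (1 + 1))).trans ?_
    exact (congrArg ((globalCechTensorInclusion M x).f (1 + 1)).hom z.2).trans (map_zero _)
  refine ⟨⟨_, hz⟩, ?_⟩
  refine congrArg (cohomologyClass (globalCechTensor M x) 1) (Subtype.ext ?_)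
  exact congrArg (fun f => f.hom z.1)
    (IsIso.hom_inv_id ((globalCechTensorInclusion M x).f (0 + 1)))

theorem toGlobalCech_apply (m : M) :
    toGlobalCech x M m = globalCechClass x M ⟨cechUnit x M m, cechUnit_mem_ker x M m⟩ := rfl

theorem transformToGlobalCech_apply (f : IdealTransform (idealOf x) M) :
    transformToGlobalCech x M f =
      globalCechClass x M ⟨transformToCech x M f, transformToCech_cocycle x M f⟩ := rfl

theorem transformToGlobalCech_injective : Function.Injective (transformToGlobalCech x M) :=
  fun _ _ h => transformToCech_injective x M
    (congrArg Subtype.val (globalCechClass_injective x M h))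

theorem transformToGlobalCech_toIdealTransform (m : M) :
    transformToGlobalCech x M (toIdealTransform (idealOf x) M m) = toGlobalCech x M m :=
  congrArg (globalCechClass x M) (Subtype.ext (cechUnit_eq_transformToCech x M m).symm)

theorem toGlobalCech_eq_zero_iff (m : M) :
    toGlobalCech x M m = 0 ↔ m ∈ torsionSubmodule (idealOf x) M := by
  rw [← cechUnit_eq_zero_iff, toGlobalCech_apply,
    map_eq_zero_iff _ (globalCechClass_injective x M), Submodule.mk_eq_zero]

theorem toIdealTransform_eq_zero_iff (m : M) :
    toIdealTransform (idealOf x) M m = 0 ↔ m ∈ torsionSubmodule (idealOf x) M := by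
  rw [← toGlobalCech_eq_zero_iff, ← transformToGlobalCech_toIdealTransform,
    map_eq_zero_iff _ (transformToGlobalCech_injective x M)]

/-- For a class represented by a cocycle `z`, both conditions say that `z = (m/1)_i` for some `m`.
-/
theorem toGlobalCech_exact : Function.Exact (toGlobalCech x M) (globalCechToCech x M) := by
  intro c
  obtain ⟨z, rfl⟩ := globalCechClass_surjective x M c
  rw [globalCechToCech_globalCechClass, cechClass_eq_zero_iff]
  refine exists_congr fun m => ?_
  rw [toGlobalCech_apply, (globalCechClass_injective x M).eq_iff, Subtype.ext_iff]

theorem globalCechToCech_surjective : Function.Surjective (globalCechToCech x M) := by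
  intro c
  obtain ⟨z, rfl⟩ := cechClass_surjective x M c
  exact ⟨_, globalCechToCech_globalCechClass x M z⟩

theorem cechCohomologyZeroToModule_injective :
    Function.Injective (cechCohomologyZeroToModule x M) := by
  refine (TensorProduct.lid R M).injective.comp
    (((cechZero x).symm.rTensor M).injective.comp ?_)
  exact (ModuleCat.mono_iff_injective _).1 inferInstance

/-- `H^0` is the kernel of `d^0`, and under `Č_x^0 ⊗ M ≅ M` the differential becomes `cechUnit`. -/
theorem cechCohomologyZeroToModule_exact :
    Function.Exact (cechCohomologyZeroToModule x M) (toGlobalCech x M) := by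
  have h1 : (cechZero x).symm 1 = 1 := by
    rw [LinearEquiv.symm_apply_eq, cechZero_one]
  intro m
  rw [toGlobalCech_apply, map_eq_zero_iff _ (globalCechClass_injective x M), Submodule.mk_eq_zero]
  have hd : cechUnit x M m = ((cechTensor M x).d 0 1).hom ((1 : CechTerm x 0) ⊗ₜ[R] m) :=
    (cechTensor_d_apply x M 0 (1 ⊗ₜ[R] m)).symm
  rw [hd]
  constructor
  · intro h
    obtain ⟨w, hw⟩ : ∃ w, ((cechTensor M x).iCycles 0).hom w = (1 : CechTerm x 0) ⊗ₜ[R] m := by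
      have := (ShortComplex.ShortExact.moduleCat_exact_iff_function_exact _).1
        (ShortComplex.exact_of_f_is_kernel
          (ShortComplex.mk ((cechTensor M x).iCycles 0) ((cechTensor M x).d 0 1)
            ((cechTensor M x).iCycles_d 0 1))
          ((cechTensor M x).cyclesIsKernel 0 1 (by simp)))
      exact (this _).1 h
    refine ⟨((cechTensor M x).isoHomologyπ₀.hom).hom w, ?_⟩
    have h2 : ((cechTensor M x).isoHomologyπ₀.inv).hom
        (((cechTensor M x).isoHomologyπ₀.hom).hom w) = w :=
      congrArg (fun f => f.hom w) (cechTensor M x).isoHomologyπ₀.hom_inv_id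
    change TensorProduct.lid R M ((cechZero x).symm.toLinearMap.rTensor M
      (((cechTensor M x).iCycles 0).hom _)) = m
    erw [h2, hw]
    rw [LinearMap.rTensor_tmul]
    simp [h1]
  · rintro ⟨c, rfl⟩
    -- Passing to `M` and back by `m ↦ 1 ⊗ m` recovers the underlying cycle, which `d^0` kills.
    have h2 : (1 : CechTerm x 0) ⊗ₜ[R] (cechCohomologyZeroToModule x M c) =
        ((cechTensor M x).iCycles 0).hom (((cechTensor M x).isoHomologyπ₀.inv).hom c) := by
      obtain ⟨m, hm⟩ := exists_one_tmul_eq x M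
        (((cechTensor M x).iCycles 0).hom (((cechTensor M x).isoHomologyπ₀.inv).hom c))
      have h3 : cechCohomologyZeroToModule x M c = m := by
        refine (congrArg (fun z => TensorProduct.lid R M
          ((cechZero x).symm.toLinearMap.rTensor M z)) hm).trans ?_
        simp [h1]
      rw [h3]
      exact hm.symm
    refine (congrArg ((cechTensor M x).d 0 1).hom h2).trans ?_
    exact congrArg (fun f => f.hom (((cechTensor M x).isoHomologyπ₀.inv).hom c))
      ((cechTensor M x).iCycles_d 0 1)

end CechCohomology

end CechTransform

namespace CechTransform

open TensorProduct

/-! ### Local cohomology through an injective resolution, and the upper row. -/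

section LocalCohomology

variable {R : Type u} [CommRing R] {k : ℕ} (x : Fin k → R)
  {M : Type u} [AddCommGroup M] [Module R M] (I : InjectiveResolution (ModuleCat.of R M))

theorem transformToCechAux_naturality {N : Type u} [AddCommGroup N] [Module R N] (f : M →ₗ[R] N)
    (n : ℕ) (g : ↥(idealOf x ^ n) →ₗ[R] M) :
    f.lTensor (CechTerm x 1) (transformToCechAux x M n g) =
      transformToCechAux x N n (f ∘ₗ g) := by
  simp [transformToCechAux_apply]

theorem lTensor_transformToCechAux (n : ℕ) (g : ↥(idealOf x ^ n) →ₗ[R] M) (y : I.cocomplex.X 0)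
    (hy : ∀ r : ↥(idealOf x ^ n), r.1 • y = resolutionUnit I (g r)) :
    (resolutionUnit I).lTensor (CechTerm x 1) (transformToCechAux x M n g) =
      cechUnit x (I.cocomplex.X 0) y := by
  -- The family `(y/1)_i` comes from `r ↦ r y` at level 0; restricted to `a ^ n`, this map is `g`
  -- followed by `M → I^0`.
  rw [transformToCechAux_naturality, cechUnit_eq_transformToCechAux,
    ← transformToCechAux_restrict x _ 0 n (Nat.zero_le n)]
  congr 1
  ext r
  exact (hy r).symm

/-- One element `y ∈ I^0` extending `g` computes both sides: `d y` represents the class in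
`H^1(Γ_a(I))`, and `(y/1)_i` is the image of the cocycle of `g`. -/
theorem resolutionToCech_transformToResolution (f : IdealTransform (idealOf x) M) :
    resolutionToCech x I (transformToResolution I (idealOf x) f) =
      cechClass x M ⟨transformToCech x M f, transformToCech_cocycle x M f⟩ := by
  obtain ⟨n, g, rfl⟩ := Module.DirectLimit.exists_of f
  obtain ⟨y, hy⟩ := exists_extension I (idealOf x) n g
  have h : transformToResolution I (idealOf x) (IdealTransform.of (idealOf x) M n g) =
      homToResolution I (idealOf x) n g := Module.DirectLimit.lift_of _ _ _
  rw [h, homToResolution_apply I _ n g y hy]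
  refine resolutionToCech_apply x I y _ ?_
  refine (congrArg _ (transformToCech_of x M n g)).trans ?_
  exact lTensor_transformToCechAux x I n g y hy

/-- If the cocycle attached to `y` is `(m/1)_i`, then `y - m` vanishes in every `(I^0)_{x_i}`. It is
therefore torsion, and has the same differential as `y`. -/
theorem resolutionToCech_injective : Function.Injective (resolutionToCech x I) := by
  refine (injective_iff_map_eq_zero _).2 fun c hc => ?_
  obtain ⟨y, rfl⟩ := resolutionClass_surjective I (idealOf x) c
  obtain ⟨z, hz, -⟩ := exists_unique_cocycle x (resolutionUnit I) (I.cocomplex.d 0 1).hom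
    (resolutionUnit_injective I) (resolutionUnit_exact I) y.2
  rw [resolutionToCech_apply x I y
    ⟨z, cocycle_of_lTensor_eq x _ (resolutionUnit_injective I) hz⟩ hz,
    cechClass_eq_zero_iff] at hc
  obtain ⟨m, rfl⟩ := hc
  have ht : y.1 - resolutionUnit I m ∈ torsionSubmodule (idealOf x) (I.cocomplex.X 0) := by
    rw [← cechUnit_eq_zero_iff, map_sub, ← hz, cechUnit_naturality, sub_self]
  refine (cohomologyClass_eq_zero_iff (torsionComplex I (idealOf x)) 0 _).2
    ⟨⟨_, ht⟩, Subtype.ext ?_⟩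
  have h : (I.cocomplex.d 0 1).hom (y.1 - resolutionUnit I m) = (I.cocomplex.d 0 1).hom y.1 := by
    rw [map_sub, (resolutionUnit_exact I).apply_apply_eq_zero, sub_zero]
  exact h

/-- If `a ^ n` kills `d y`, then `r y` lies in `ker d = M` for `r ∈ a ^ n`, and `r ↦ r y` is the
required map `a ^ n → M`. -/
theorem transformToResolution_surjective (a : Ideal R) :
    Function.Surjective (transformToResolution I a) := by
  intro c
  obtain ⟨y, rfl⟩ := resolutionClass_surjective I a c
  obtain ⟨n, hn⟩ := y.2
  have hmem : ∀ r : ↥(a ^ n), r.1 • y.1 ∈ LinearMap.range (resolutionUnit I) := fun r =>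
    (resolutionUnit_exact I _).1 (by rw [map_smul]; exact hn r.1 r.2)
  set e := LinearEquiv.ofInjective (resolutionUnit I) (resolutionUnit_injective I)
  set g : ↥(a ^ n) →ₗ[R] M := e.symm.toLinearMap ∘ₗ
    ((LinearMap.toSpanSingleton R _ y.1) ∘ₗ (a ^ n).subtype).codRestrict _ hmem with hg
  refine ⟨IdealTransform.of a M n g, ?_⟩
  refine (Module.DirectLimit.lift_of _ _ _).trans (homToResolution_apply I a n g y fun r => ?_)
  exact (congrArg Subtype.val (e.apply_symm_apply ⟨r.1 • y.1, hmem r⟩)).symm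

theorem localCohomologyToCech_injective : Function.Injective (localCohomologyToCech x M) := by
  refine (resolutionToCech_injective x _).comp ?_
  exact (ModuleCat.mono_iff_injective _).1 inferInstance

theorem transformToLocalCohomology_surjective (a : Ideal R) :
    Function.Surjective (transformToLocalCohomology M a) := by
  intro c
  obtain ⟨d, hd⟩ := (ModuleCat.epi_iff_surjective
    (InjectiveResolution.isoRightDerivedObj (injectiveResolution (ModuleCat.of R M))
      (torsionFunctor a) 1).inv).1 inferInstance c
  obtain ⟨f, rfl⟩ := transformToResolution_surjective _ a d
  exact ⟨f, hd⟩

theorem localCohomologyToCech_transformToLocalCohomology (f : IdealTransform (idealOf x) M) :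
    localCohomologyToCech x M (transformToLocalCohomology M (idealOf x) f) =
      globalCechToCech x M (transformToGlobalCech x M f) := by
  rw [transformToGlobalCech_apply, globalCechToCech_globalCechClass,
    ← resolutionToCech_transformToResolution x (injectiveResolution (ModuleCat.of R M))]
  exact congrArg (resolutionToCech x (injectiveResolution (ModuleCat.of R M)))
    (congrArg (fun φ => φ.hom (transformToResolution (injectiveResolution (ModuleCat.of R M))
        (idealOf x) f))
      (InjectiveResolution.isoRightDerivedObj (injectiveResolution (ModuleCat.of R M))
        (torsionFunctor (idealOf x)) 1).inv_hom_id)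

-- Both vertical maps are injective, so exactness descends from the lower row: `f` dies in
-- `H^1_a(M)` iff `ρ_M f` dies in `H^1(Č_x ⊗ M)`, iff `ρ_M f = ρ_M (τ_M m)` for some `m`, iff `f =
-- τ_M m`.
variable (M) in
theorem toIdealTransform_exact :
    Function.Exact (toIdealTransform (idealOf x) M)
      (transformToLocalCohomology M (idealOf x)) := by
  intro f
  rw [← map_eq_zero_iff _ (localCohomologyToCech_injective x),
    localCohomologyToCech_transformToLocalCohomology, toGlobalCech_exact x M _]
  refine exists_congr fun m => ?_
  rw [← transformToGlobalCech_toIdealTransform, (transformToGlobalCech_injective x M).eq_iff]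

end LocalCohomology

/-! ### Deligne's formula for weakly pro-regular sequences. -/

section Deligne

variable {R : Type u} [CommRing R] {k : ℕ} {x : Fin k → R}
  {M : Type u} [AddCommGroup M] [Module R M]

theorem exists_d_eq_of_homologyMap_eq_zero {K L : ChainComplex (ModuleCat.{u} R) ℕ} (φ : K ⟶ L)
    (n : ℕ) (h : HomologicalComplex.homologyMap φ (n + 1) = 0) (z : K.X (n + 1))
    (hz : (K.d (n + 1) n).hom z = 0) :
    ∃ w, (L.d (n + 1 + 1) (n + 1)).hom w = (φ.f (n + 1)).hom z := by
  set j := K.liftCycles (ModuleCat.ofHom (LinearMap.ker (K.d (n + 1) n).hom).subtype) n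
    (by simp) (by ext z; exact z.2)
  have hj : j ≫ K.iCycles (n + 1) =
      ModuleCat.ofHom (LinearMap.ker (K.d (n + 1) n).hom).subtype := K.liftCycles_i _ _ _ _
  have h0 : (j ≫ HomologicalComplex.cyclesMap φ (n + 1)) ≫ L.homologyπ (n + 1) = 0 := by
    rw [Category.assoc, ← HomologicalComplex.homologyπ_naturality, h, Limits.comp_zero,
      Limits.comp_zero]
  have hex := (ShortComplex.ShortExact.moduleCat_exact_iff_function_exact _).1
    (ShortComplex.exact_of_g_is_cokernel
      (ShortComplex.mk (L.toCycles (n + 1 + 1) (n + 1)) (L.homologyπ (n + 1)) (by simp))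
      (L.homologyIsCokernel (n + 1 + 1) (n + 1) (by simp)))
  obtain ⟨w, hw⟩ := (hex _).1 (congrArg (fun f => f.hom ⟨z, hz⟩) h0)
  refine ⟨w, ?_⟩
  rw [← L.toCycles_i (n + 1 + 1) (n + 1)]
  refine (congrArg (L.iCycles (n + 1)).hom hw).trans ?_
  have h1 : (j ≫ HomologicalComplex.cyclesMap φ (n + 1)) ≫ L.iCycles (n + 1) =
      ModuleCat.ofHom (LinearMap.ker (K.d (n + 1) n).hom).subtype ≫ φ.f (n + 1) := by
    rw [Category.assoc, HomologicalComplex.cyclesMap_i, ← Category.assoc, hj]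
  exact congrArg (fun f => f.hom ⟨z, hz⟩) h1

/-- Degree one of weak pro-regularity, in elements: a relation among the `x_i ^ m`, scaled termwise
by `x_i ^ (m - n)`, is a combination of the trivial relations among the `x_i ^ n`. -/
theorem exists_koszulD_eq_of_weaklyProRegular (hx : WeaklyProRegular x) (n : ℕ) (hn : 1 ≤ n) :
    ∃ m, n ≤ m ∧ ∀ z, koszulD (fun i => x i ^ m) 0 z = 0 →
      ∃ w, koszulD (fun i => x i ^ n) 1 w = koszulScale (fun i => x i ^ (m - n)) 1 z := by
  obtain ⟨m, h, hm⟩ := hx 1 le_rfl n hn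
  refine ⟨m, h, fun z hz => ?_⟩
  obtain ⟨w, hw⟩ := exists_d_eq_of_homologyMap_eq_zero _ 0 hm z
    ((congrArg (fun f => f.hom z) (koszulComplex_d (fun i => x i ^ m) 0)).trans hz)
  exact ⟨w, (congrArg (fun f => f.hom w) (koszulComplex_d (fun i => x i ^ n) 1)).symm.trans hw⟩

theorem exists_common_denominator (c : CechTerm x 1 ⊗[R] M) :
    ∃ (n : ℕ) (v : (Fin 1 ↪o Fin k) → M),
      ∀ σ, cechProj x M σ c = invPow (cechElem x σ) n ⊗ₜ[R] v σ := by
  choose n v hv using fun σ => exists_eq_invPow_tmul _ (cechProj x M σ c)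
  -- The sum serves as a common upper bound of the finitely many exponents.
  refine ⟨∑ σ, n σ, fun σ => cechElem x σ ^ (∑ σ, n σ - n σ) • v σ, fun σ => ?_⟩
  have h : n σ ≤ ∑ σ, n σ := Finset.single_le_sum (fun _ _ => Nat.zero_le _) (Finset.mem_univ σ)
  have h' := invPow_tmul_pow_smul (cechElem x σ) (n σ) (∑ σ, n σ - n σ) (v σ)
  rw [Nat.sub_add_cancel h] at h'
  exact (hv σ).trans h'.symm

theorem cechFace_rTensor_cechProj_eq {c : CechTerm x 1 ⊗[R] M} (hc : (cechD x 1).rTensor M c = 0)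
    (τ : Fin 2 ↪o Fin k) :
    (cechFace x τ 0).toLinearMap.rTensor M (cechProj x M (face τ 0) c) =
      (cechFace x τ 1).toLinearMap.rTensor M (cechProj x M (face τ 1) c) := by
  have h : (LinearMap.proj τ : CechTerm x 2 →ₗ[R] _) ∘ₗ cechD x 1 =
      (cechFace x τ 0).toLinearMap ∘ₗ LinearMap.proj (face τ 0) -
        (cechFace x τ 1).toLinearMap ∘ₗ LinearMap.proj (face τ 1) := by
    ext c
    simp [cechD_apply, Fin.sum_univ_two, sub_eq_add_neg]
  have h' := congrArg (cechProj x M τ) hc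
  rw [← LinearMap.comp_apply, ← LinearMap.rTensor_comp, h, LinearMap.rTensor_sub,
    LinearMap.sub_apply, map_zero, sub_eq_zero, LinearMap.rTensor_comp, LinearMap.rTensor_comp] at h'
  exact h'

/-- Here `u = 1/r` and `v = 1/s` in `R_t`; multiplying by `r s` clears denominators, and equality in
`M_t` means equality up to a power of `t`. -/
theorem exists_smul_eq_smul_of_tmul_eq {r s t : R} {u v : Localization.Away t} {m m' : M}
    (hu : r • u = 1) (hv : s • v = 1) (h : u ⊗ₜ[R] m = v ⊗ₜ[R] m') :
    ∃ l : ℕ, t ^ l • (s • m) = t ^ l • (r • m') := by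
  have h1 : (1 : Localization.Away t) ⊗ₜ[R] (s • m - r • m') = 0 := by
    rw [TensorProduct.tmul_sub, sub_eq_zero, TensorProduct.tmul_smul, TensorProduct.tmul_smul]
    conv_lhs => rw [← hu, ← TensorProduct.smul_tmul', h]
    conv_rhs => rw [← hv, ← TensorProduct.smul_tmul', smul_comm]
  obtain ⟨l, hl⟩ := (one_tmul_eq_zero_iff _ _).1 h1
  exact ⟨l, by rwa [smul_sub, sub_eq_zero] at hl⟩

/-- The cocycle condition yields `x_j ^ n m_i = x_i ^ n m_j` only up to a power of `x_i x_j`.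
Expanding each fraction by `x_i ^ N`, with `N` large, absorbs these powers. -/
theorem exists_compatible_numerators {c : CechTerm x 1 ⊗[R] M}
    (hc : (cechD x 1).rTensor M c = 0) :
    ∃ (n : ℕ) (v : (Fin 1 ↪o Fin k) → M), 1 ≤ n ∧
      (∀ σ, cechProj x M σ c = invPow (cechElem x σ) n ⊗ₜ[R] v σ) ∧
      ∀ τ : Fin 2 ↪o Fin k, cechElem x (face τ 1) ^ n • v (face τ 0) =
        cechElem x (face τ 0) ^ n • v (face τ 1) := by
  obtain ⟨n, v, hv⟩ := exists_common_denominator c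
  have key : ∀ τ : Fin 2 ↪o Fin k, ∃ l : ℕ,
      cechElem x τ ^ l • (cechElem x (face τ 1) ^ n • v (face τ 0)) =
        cechElem x τ ^ l • (cechElem x (face τ 0) ^ n • v (face τ 1)) := by
    intro τ
    have h := cechFace_rTensor_cechProj_eq hc τ
    rw [hv, hv, LinearMap.rTensor_tmul, LinearMap.rTensor_tmul] at h
    have h2 : ∀ j, cechElem x (face τ j) ^ n •
        (cechFace x τ j).toLinearMap (invPow (cechElem x (face τ j)) n) = 1 := fun j => by
      rw [← map_smul, pow_smul_invPow]
      exact map_one (cechFace x τ j)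
    exact exists_smul_eq_smul_of_tmul_eq (h2 0) (h2 1) h
  choose l hl using key
  -- The extra 1 makes the final exponent positive, as the definition of weak pro-regularity
  -- demands.
  set N := ∑ τ, l τ + 1 with hN
  refine ⟨N + n, fun σ => cechElem x σ ^ N • v σ, by omega, fun σ => ?_, fun τ => ?_⟩
  · rw [invPow_tmul_pow_smul, hv]
  · have hle : l τ ≤ N :=
      (Finset.single_le_sum (fun _ _ => Nat.zero_le _) (Finset.mem_univ τ)).trans (Nat.le_succ _)
    have hτ : cechElem x τ = cechElem x (face τ 1) * cechElem x (face τ 0) := by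
      rw [cechElem_eq x τ 0]
      congr 1
      simp only [cechElem, Fin.prod_univ_one]
      rfl
    have h := congrArg (fun m => cechElem x τ ^ (N - l τ) • m) (hl τ)
    simp only [smul_smul] at h
    rw [← mul_assoc, ← mul_assoc, ← pow_add, Nat.sub_add_cancel hle, hτ] at h
    simp only [smul_smul]
    convert h using 2 <;> ring

/-- The linear map that sends `e_σ` to `v σ`. -/
noncomputable abbrev koszulEval (v : (Fin 1 ↪o Fin k) → M) : ((Fin 1 ↪o Fin k) → R) →ₗ[R] M :=
  Fintype.linearCombination R v

/-- The boundary of `e_τ`, for `τ = (i < j)`, is `x_i ^ n e_j - x_j ^ n e_i`, which the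
compatibility of the numerators sends to zero. -/
theorem koszulEval_comp_koszulD (n : ℕ) (v : (Fin 1 ↪o Fin k) → M)
    (hv : ∀ τ : Fin 2 ↪o Fin k, cechElem x (face τ 1) ^ n • v (face τ 0) =
        cechElem x (face τ 0) ^ n • v (face τ 1)) :
    koszulEval v ∘ₗ koszulD (fun i => x i ^ n) 1 = 0 := by
  refine LinearMap.pi_ext fun τ r => ?_
  have h0 : x (τ 0) = cechElem x (face τ 1) := by
    simp only [cechElem, Fin.prod_univ_one]; rfl
  have h1 : x (τ 1) = cechElem x (face τ 0) := by
    simp only [cechElem, Fin.prod_univ_one]; rfl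
  simp only [LinearMap.comp_apply, koszulD_single, map_sum, map_smul,
    Fintype.linearCombination_apply_single, LinearMap.zero_apply]
  refine (Fin.sum_univ_two _).trans ?_
  have h := congrArg (fun m => r • m) (hv τ)
  simp only [smul_smul, Fin.val_zero, Fin.val_one, pow_zero, pow_one, one_mul, neg_mul,
    neg_smul, h0, h1] at h ⊢
  rw [mul_comm _ r, mul_comm _ r, h, add_neg_cancel]

theorem transformToCech_range_of_weaklyProRegular (hx : WeaklyProRegular x)
    {c : CechTerm x 1 ⊗[R] M} (hc : (cechD x 1).rTensor M c = 0) :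
    ∃ f, transformToCech x M f = c := by
  obtain ⟨n, v, hn, hcv, hv⟩ := exists_compatible_numerators hc
  obtain ⟨m, hnm, hm⟩ := exists_koszulD_eq_of_weaklyProRegular hx n hn
  -- `A` sends `e_i` to `x_i ^ m` and has the ideal of the `x_i ^ m` as its image; `B` sends `e_i`
  -- to `x_i ^ (m - n) v_i`. The aim is to factor `B` through `A`.
  set A : ((Fin 1 ↪o Fin k) → R) →ₗ[R] R :=
    LinearMap.proj default ∘ₗ koszulD (fun i => x i ^ m) 0 with hA
  set B : ((Fin 1 ↪o Fin k) → R) →ₗ[R] M :=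
    koszulEval v ∘ₗ koszulScale (fun i => x i ^ (m - n)) 1 with hB
  have hAB : LinearMap.ker A ≤ LinearMap.ker B := by
    intro z hz
    have hz' : koszulD (fun i => x i ^ m) 0 z = 0 := by
      funext σ
      rw [Subsingleton.elim σ default]
      exact hz
    obtain ⟨w, hw⟩ := hm z hz'
    rw [LinearMap.mem_ker, hB, LinearMap.comp_apply, ← hw, ← LinearMap.comp_apply,
      koszulEval_comp_koszulD n v hv, LinearMap.zero_apply]
  have hAs : ∀ σ r, A (Pi.single σ r) = r * cechElem x σ ^ m := by
    intro σ r
    rw [hA, LinearMap.comp_apply, koszulD_single]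
    simp [cechElem, Subsingleton.elim (face σ 0) default, mul_comm]
  have hBs : ∀ σ r, B (Pi.single σ r) = (r * cechElem x σ ^ (m - n)) • v σ := by
    intro σ r
    rw [hB, LinearMap.comp_apply, koszulScale_single, map_smul,
      Fintype.linearCombination_apply_single, smul_smul]
    simp [cechElem, mul_comm]
  obtain ⟨N, hN⟩ := exists_idealOf_pow_le (x := x) (J := LinearMap.range A) fun σ =>
    ⟨m, Pi.single σ 1, by rw [hAs, one_mul]⟩
  -- At level `N + m` the element `x_i ^ (N + m)` is visibly `A (x_i ^ N e_i)`, so the value of `G`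
  -- on it is explicit.
  have hN' : idealOf x ^ (N + m) ≤ LinearMap.range A :=
    (Ideal.pow_le_pow_right (Nat.le_add_right _ _)).trans hN
  set G : LinearMap.range A →ₗ[R] M :=
    (LinearMap.ker A).liftQ B hAB ∘ₗ A.quotKerEquivRange.symm.toLinearMap with hG
  have hGA : ∀ z (h : A z ∈ LinearMap.range A), G ⟨A z, h⟩ = B z := by
    intro z h
    have h' : A.quotKerEquivRange.symm ⟨A z, h⟩ = Submodule.Quotient.mk z := by
      rw [LinearEquiv.symm_apply_eq]
      rfl
    rw [hG, LinearMap.comp_apply, LinearEquiv.coe_coe, h']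
    rfl
  refine ⟨IdealTransform.of (idealOf x) M (N + m) (G ∘ₗ Submodule.inclusion hN'), ?_⟩
  rw [transformToCech_of, cechTensor_ext_iff]
  intro σ
  rw [cechProj_transformToCechAux, hcv]
  have h1 : A (Pi.single σ (cechElem x σ ^ N)) = cechElem x σ ^ (N + m) := by
    rw [hAs, pow_add]
  have h2 : (G ∘ₗ Submodule.inclusion hN') ⟨cechElem x σ ^ (N + m), cechElem_pow_mem x σ (N + m)⟩ =
      cechElem x σ ^ (N + (m - n)) • v σ := by
    rw [pow_add (cechElem x σ) N (m - n), ← hBs,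
      ← hGA _ (h1 ▸ hN' (cechElem_pow_mem x σ (N + m)))]
    exact congrArg G (Subtype.ext h1.symm)
  rw [h2]
  -- Cancelling `x_i ^ (N + (m - n))` from numerator and denominator leaves `v_i / x_i ^ n`.
  have h3 : N + m = N + (m - n) + n := by omega
  conv_lhs => rw [h3]
  exact invPow_tmul_pow_smul _ _ _ _

theorem transformToGlobalCech_surjective_of_weaklyProRegular (hx : WeaklyProRegular x) :
    Function.Surjective (transformToGlobalCech x M) := by
  intro c
  obtain ⟨z, rfl⟩ := globalCechClass_surjective x M c
  obtain ⟨f, hf⟩ := transformToCech_range_of_weaklyProRegular hx z.2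
  exact ⟨f, congrArg (globalCechClass x M) (Subtype.ext hf)⟩

end Deligne

end CechTransform

namespace CechTransform

/-! ### Comparison of cokernels by a diagram chase. -/

section Cokernels

variable {R A B C D H : Type*} [Ring R] [AddCommGroup A] [Module R A] [AddCommGroup B] [Module R B]
  [AddCommGroup C] [Module R C] [AddCommGroup D] [Module R D] [AddCommGroup H] [Module R H]

/-- In a commutative diagram with rows `A → D → H → 0` and `A → B → C → 0`, the lower one exact,
the cokernels of `D → B` and `H → C` agree. -/
theorem exists_quotient_range_equiv {u : A →ₗ[R] B} {g : B →ₗ[R] C} {t : A →ₗ[R] D}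
    {ρ : D →ₗ[R] B} {l : H →ₗ[R] C} {q : D →ₗ[R] H} (hug : Function.Exact u g)
    (hg : Function.Surjective g) (hsq : l ∘ₗ q = g ∘ₗ ρ) (htri : ρ ∘ₗ t = u)
    (hq : Function.Surjective q) :
    ∃ e : (B ⧸ LinearMap.range ρ) ≃ₗ[R] (C ⧸ LinearMap.range l),
      ∀ b, e (Submodule.Quotient.mk b) = Submodule.Quotient.mk (g b) := by
  have hker : LinearMap.ker ((LinearMap.range l).mkQ ∘ₗ g) = LinearMap.range ρ := by
    ext b
    rw [LinearMap.ker_comp, Submodule.ker_mkQ, Submodule.mem_comap]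
    constructor
    · rintro ⟨h, hh⟩
      obtain ⟨d, rfl⟩ := hq h
      -- The difference `b - ρ d` comes from `A`, hence lies in the image of `ρ` because `u` factors
      -- through `t`.
      have h0 : g (b - ρ d) = 0 := by
        rw [map_sub, ← hh, sub_eq_zero]
        exact LinearMap.congr_fun hsq d
      obtain ⟨a, ha⟩ := (hug _).1 h0
      refine ⟨t a + d, ?_⟩
      rw [map_add, ← LinearMap.comp_apply, htri, ha, sub_add_cancel]
    · rintro ⟨d, rfl⟩
      exact ⟨q d, LinearMap.congr_fun hsq d⟩
  refine ⟨Submodule.quotEquivOfEq _ _ hker.symm ≪≫ₗ LinearMap.quotKerEquivOfSurjective _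
    ((Submodule.mkQ_surjective _).comp hg), fun b => rfl⟩

end Cokernels

end CechTransform

/-! ### Assembly of the diagram and its consequences. -/

theorem corollary5p4 {R : Type u} [CommRing R] {k : ℕ} (x : Fin k → R)
    (M : Type u) [AddCommGroup M] [Module R M] :
    -- (a) injectivity of the natural map `H^1_a(M) → H^1(Č_x ⊗ M)`
    Function.Injective (localCohomologyToCech x M) ∧
    -- exactness of the upper row `0 → Γ_a(M) → M → D_a(M) → H^1_a(M) → 0`
    (Function.Injective (torsionSubmodule (idealOf x) M).subtype ∧
      Function.Exact (torsionSubmodule (idealOf x) M).subtype (toIdealTransform (idealOf x) M) ∧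
      Function.Exact (toIdealTransform (idealOf x) M)
        (transformToLocalCohomology M (idealOf x)) ∧
      Function.Surjective (transformToLocalCohomology M (idealOf x))) ∧
    -- exactness of the lower row `0 → H^0(Č_x ⊗ M) → M → H^1(Ď_x ⊗ M) → H^1(Č_x ⊗ M) → 0`
    (Function.Injective (cechCohomologyZeroToModule x M) ∧
      Function.Exact (cechCohomologyZeroToModule x M) (toGlobalCech x M) ∧
      Function.Exact (toGlobalCech x M) (globalCechToCech x M) ∧
      Function.Surjective (globalCechToCech x M)) ∧
    -- commutativity of the three squares, and the vertical maps
    (∃ e : torsionSubmodule (idealOf x) M ≃ₗ[R] (cechTensor M x).homology 0,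
      cechCohomologyZeroToModule x M ∘ₗ e.toLinearMap =
        (torsionSubmodule (idealOf x) M).subtype) ∧
    transformToGlobalCech x M ∘ₗ toIdealTransform (idealOf x) M = toGlobalCech x M ∧
    localCohomologyToCech x M ∘ₗ transformToLocalCohomology M (idealOf x) =
      globalCechToCech x M ∘ₗ transformToGlobalCech x M ∧
    Function.Injective (transformToGlobalCech x M) ∧
    -- the induced isomorphism of the cokernels of the last two vertical maps
    (∃ e : ((globalCechTensor M x).homology 1 ⧸ LinearMap.range (transformToGlobalCech x M)) ≃ₗ[R]
        ((cechTensor M x).homology 1 ⧸ LinearMap.range (localCohomologyToCech x M)),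
      ∀ c, e (Submodule.Quotient.mk c) = Submodule.Quotient.mk (globalCechToCech x M c)) ∧
    -- (b) the natural injection of `M / Γ_a(M)` factors through `D_a(M)`
    (∃ h : torsionSubmodule (idealOf x) M ≤ LinearMap.ker (toGlobalCech x M),
      Function.Injective ((torsionSubmodule (idealOf x) M).liftQ (toGlobalCech x M) h) ∧
      ∃ i : (M ⧸ torsionSubmodule (idealOf x) M) →ₗ[R] IdealTransform (idealOf x) M,
        i ∘ₗ (torsionSubmodule (idealOf x) M).mkQ = toIdealTransform (idealOf x) M ∧
        transformToGlobalCech x M ∘ₗ i =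
          (torsionSubmodule (idealOf x) M).liftQ (toGlobalCech x M) h) ∧
    -- (c) Deligne's formula
    (WeaklyProRegular x → Function.Bijective (transformToGlobalCech x M)) := by
  have hexact := cechCohomologyZeroToModule_exact x M
  -- Both submodules are the kernel of `M → H^1(Ď_x ⊗ M)`; this provides the left vertical
  -- isomorphism.
  have htors : LinearMap.range (cechCohomologyZeroToModule x M) =
      torsionSubmodule (idealOf x) M := by
    ext m
    exact (hexact m).symm.trans (toGlobalCech_eq_zero_iff x M m)
  have htrans : transformToGlobalCech x M ∘ₗ toIdealTransform (idealOf x) M = toGlobalCech x M :=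
    LinearMap.ext (transformToGlobalCech_toIdealTransform x M)
  have hlocal : localCohomologyToCech x M ∘ₗ transformToLocalCohomology M (idealOf x) =
      globalCechToCech x M ∘ₗ transformToGlobalCech x M :=
    LinearMap.ext (localCohomologyToCech_transformToLocalCohomology x)
  have hker : torsionSubmodule (idealOf x) M ≤ LinearMap.ker (toGlobalCech x M) :=
    fun m hm => (toGlobalCech_eq_zero_iff x M m).2 hm
  have hker' : torsionSubmodule (idealOf x) M ≤ LinearMap.ker (toIdealTransform (idealOf x) M) :=
    fun m hm => (toIdealTransform_eq_zero_iff x M m).2 hm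
  refine ⟨localCohomologyToCech_injective x,
    ⟨Submodule.subtype_injective _, fun m => ?_, toIdealTransform_exact x M,
      transformToLocalCohomology_surjective _⟩,
    ⟨cechCohomologyZeroToModule_injective x M, hexact, toGlobalCech_exact x M,
      globalCechToCech_surjective x M⟩,
    ?_, htrans, hlocal, transformToGlobalCech_injective x M, ?_, ⟨hker, ?_, ?_⟩, fun hx =>
      ⟨transformToGlobalCech_injective x M,
        transformToGlobalCech_surjective_of_weaklyProRegular hx⟩⟩
  · rw [toIdealTransform_eq_zero_iff]
    simp
  · let e := LinearEquiv.ofInjective _ (cechCohomologyZeroToModule_injective x M)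
    refine ⟨LinearEquiv.ofEq _ _ htors.symm ≪≫ₗ e.symm, LinearMap.ext fun m => ?_⟩
    exact congrArg Subtype.val (e.apply_symm_apply (LinearEquiv.ofEq _ _ htors.symm m))
  · exact exists_quotient_range_equiv (toGlobalCech_exact x M) (globalCechToCech_surjective x M)
      hlocal htrans (transformToLocalCohomology_surjective _)
  · rw [← LinearMap.ker_eq_bot]
    refine Submodule.ker_liftQ_eq_bot' _ _ (Submodule.ext fun m => ?_)
    exact (toGlobalCech_eq_zero_iff x M m).symm
  · refine ⟨(torsionSubmodule (idealOf x) M).liftQ _ hker', Submodule.liftQ_mkQ _ _ _, ?_⟩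
    refine Submodule.linearMap_qext _ ?_
    rw [LinearMap.comp_assoc, Submodule.liftQ_mkQ, Submodule.liftQ_mkQ, htrans]
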